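/- **Setting.** Let $\Phi=\{x_n\}$ (base stations, BSs) be a homogeneous Poisson point process on $\mathbb R^2$ of intensity $\lambda>0$. A typical user sits at the origin. Let $M\ge 1$ be an integer, $P>0$ the transmit power, $W\ge 0$ the noise power, $\Gamma_{cs}>0$ the detection threshold. The path loss at distance $r\ge 0$ is $$l(r)=C_L r^{\alpha_L}\ \text{ if } r<R_C,\qquad l(r)=C_N r^{\alpha_N}\ \text{ if } r\ge R_C,$$ with $C_L,C_N>0$, $R_C\ge 0$, $\alpha_N\ge\max(\alpha_L,2)$, and $l$ non-decreasing. For $1\le i\le M$ let $S_M(i)$ be the sector of points whose angle lies in $[2\pi(i-1)/M,\,2\pi i/M)$, let $x_0^i$ be the (almost surely unique) point of $\Phi\cap S_M(i)$ nearest to the origin, and let $R_i=\|x_0^i\|$. Let $F_n(t)$ be the fading of the link from $x_n$ to the origin in initial access (IA) cycle $t$; these variables are i.i.d. exponential with unit mean over all links and all cycles, and independent of $\Phi$. Writing $F_0^i(t)$ for the fading of $x_0^i$, we say that sector $i$ (equivalently $x_0^i$) is detected in cycle $t\ge 1$ if $$\frac{F_0^i(t)/l(R_i)}{\sum_{x_n\in\Phi\cap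 S_M(i)\setminus\{x_0^i\}}F_n(t)/l(\|x_n\|)+W/(PM)}>\Gamma_{cs}.$$ Cell search succeeds in cycle $t$ if at least one sector is detected in it, and $$L_{cs}(M,\lambda)=\inf\{t\ge 1:\text{ cell search succeeds in cycle } t\}\in\{1,2,\dots\}\cup\{\infty\}.$$ **Lemma.** For integers $j\ge 0$ and $r>0$ put $$f_j(r,M,\lambda)=\sum_{k=0}^{j}(-1)^k\binom jk\exp\!\Big(-\frac{Wk\Gamma_{cs}\,l(r)}{PM}\Big)\exp\!\Big(-\frac{2\pi\lambda}{M}\int_r^\infty\Big(1-\frac1{(1+\Gamma_{cs}\,l(r)/l(s))^k}\Big)s\,\mathrm ds\Big),$$ where the integral takes values in $[0,\infty]$ and $\exp(-\infty)=0$. Then, almost surely: 1. for all $1\le i\le M$ and $j\ge 0$, $f_j(R_i,M,\lambda)$ is the conditional probability, given $(R_1,\dots,R_M)$, that $x_0^i$ is detected in none of the first $j$ IA cycles; 2. the conditional mean number of IA cycles for cell search is $$\mathbb E\big[L_{cs}(M,\lambda)\,\big|\,R_1,\dots,R_M\big]=\sum_{j=0}^\infty\prod_{i=1}^M f_j(R_i,M,\lambda),$$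 as an identity between random variables with values in $[0,\infty]$. -/

import Mathlib

open scoped ENNReal

noncomputable section

namespace CellSearch

open MeasureTheory ProbabilityTheory

/-- A random subset `Φ` of the plane (identified with `ℂ`) is a homogeneous Poisson point process
of intensity `lam`: the number of points in every Borel set of finite area is Poisson distributed
with mean `lam` times the area, and the numbers of points in disjoint Borel sets are independent. -/
structure IsHomogeneousPPP {Ω : Type*} [MeasurableSpace Ω] (Φ : Ω → Set ℂ) (lam : ℝ)
    (μ : Measure Ω) : Prop where
  measurable_count : ∀ B : Set ℂ, MeasurableSet B → Measurable fun ω => (Φ ω ∩ B).encard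
  count_law : ∀ B : Set ℂ, MeasurableSet B → volume B < ∞ →
    μ.map (fun ω => (Φ ω ∩ B).encard) =
      (poissonMeasure (lam * (volume B).toReal).toNNReal).map (fun n : ℕ => (n : ℕ∞))
  count_indep : ∀ (n : ℕ) (B : Fin n → Set ℂ), (∀ i, MeasurableSet (B i)) →
    Pairwise (fun i j => Disjoint (B i) (B j)) →
    iIndepFun (fun i ω => (Φ ω ∩ B i).encard) μ

/-- The deterministic parameters of the network: base station intensity `lam`, transmit power `P`,
thermal noise power `W`, detection threshold `Gam`, and the constants of the path loss. -/
structure Params where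
  lam : ℝ
  P : ℝ
  W : ℝ
  Gam : ℝ
  CL : ℝ
  CN : ℝ
  aL : ℝ
  aN : ℝ
  Rc : ℝ

namespace Params

/-- The dual-slope path loss at distance `r`. -/
def pathLoss (p : Params) (r : ℝ) : ℝ :=
  if r < p.Rc then p.CL * r ^ p.aL else p.CN * r ^ p.aN

/-- Standing assumptions on the parameters. The noise power may vanish. -/
structure Admissible (p : Params) : Prop where
  lam_pos : 0 < p.lam
  P_pos : 0 < p.P
  W_nonneg : 0 ≤ p.W
  Gam_pos : 0 < p.Gam
  CL_pos : 0 < p.CL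
  CN_pos : 0 < p.CN
  Rc_nonneg : 0 ≤ p.Rc
  aN_ge : max p.aL 2 ≤ p.aN
  monotone_pathLoss : MonotoneOn p.pathLoss (Set.Ici 0)

/-- `∫_r^∞ (1 - 1 / (1 + Gam l(r) / l(s)) ^ k) s ds`. The integrand is nonnegative and the integral
may be infinite (for instance when `aN = 2` and `1 ≤ k`), so it takes values in `[0, ∞]`. -/
def interfIntegral (p : Params) (k : ℕ) (r : ℝ) : ℝ≥0∞ :=
  ∫⁻ s in Set.Ioi r,
    ENNReal.ofReal ((1 - 1 / (1 + p.Gam * p.pathLoss r / p.pathLoss s) ^ k) * s)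

/-- The function `f_j(r, M, lam)`. The second exponential is the one of an extended real number,
with `exp (-∞) = 0`. -/
def f (p : Params) (M j : ℕ) (r : ℝ) : ℝ :=
  ∑ k ∈ Finset.range (j + 1), (-1 : ℝ) ^ k * (j.choose k : ℝ) *
    Real.exp (-(p.W * k * p.Gam * p.pathLoss r / (p.P * M))) *
    (EReal.exp (-((ENNReal.ofReal (2 * p.lam * Real.pi / M) * p.interfIntegral k r : ℝ≥0∞) :
      EReal))).toReal

end Params

/-- The angle of a point of the plane, in `[0, 2π)`. -/
def angle (z : ℂ) : ℝ := toIcoMod Real.two_pi_pos 0 z.arg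

/-- The `M` sectors seen from the origin, numbered from `0` to `M - 1`: the `i`-th one consists of
the points whose angle lies in `[2π i / M, 2π (i + 1) / M)`. -/
def sector (M : ℕ) (i : Fin M) : Set ℂ :=
  {z | z ≠ 0 ∧
    angle z ∈ Set.Ico (2 * Real.pi * ((i : ℕ) : ℝ) / M) (2 * Real.pi * (((i : ℕ) : ℝ) + 1) / M)}

/-- The random network seen by a user at the origin. The base stations form a homogeneous Poisson
point process, enumerated without repetition by `X 0, X 1, …`; `F t n` is the fading of the link
from base station `X n` in cycle `t`. The fading variables are i.i.d. exponential with unit mean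
over all links and cycles, and independent of the base station locations. -/
structure IsNetwork {Ω : Type*} [MeasurableSpace Ω] (p : Params) (X : ℕ → Ω → ℂ)
    (F : ℕ → ℕ → Ω → ℝ) (μ : Measure Ω) : Prop where
  measurable_loc : ∀ n, Measurable (X n)
  measurable_fading : ∀ t n, Measurable (F t n)
  injective_loc : ∀ᵐ ω ∂μ, Function.Injective fun n => X n ω
  poisson : IsHomogeneousPPP (fun ω => Set.range fun n => X n ω) p.lam μ
  fading_law : ∀ t n, μ.map (F t n) = expMeasure 1
  fading_indep : iIndepFun (fun (a : ℕ × ℕ) ω => F a.1 a.2 ω) μ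
  fading_indep_loc :
    IndepFun (fun ω (n : ℕ) => X n ω) (fun ω (a : ℕ × ℕ) => F a.1 a.2 ω) μ

section Model

variable {Ω : Type*} (p : Params) (X : ℕ → Ω → ℂ) (F : ℕ → ℕ → Ω → ℝ) (M : ℕ)

/-- The distance `R_i` from the origin to the nearest base station inside the `i`-th sector. -/
def nearestDist (ω : Ω) (i : Fin M) : ℝ :=
  sInf {r : ℝ | ∃ n, X n ω ∈ sector M i ∧ r = ‖X n ω‖}

/-- The base station `X n` is a nearest one inside the `i`-th sector. -/
def IsNearest (i : Fin M) (n : ℕ) (ω : Ω) : Prop :=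
  X n ω ∈ sector M i ∧ ∀ m, X m ω ∈ sector M i → ‖X n ω‖ ≤ ‖X m ω‖

/-- Power received from `X n` in cycle `t`, normalized by the transmit power and the beam gain. -/
def rxPower (t n : ℕ) (ω : Ω) : ℝ≥0∞ :=
  ENNReal.ofReal (F t n ω / p.pathLoss ‖X n ω‖)

open Classical in
/-- Interference at the origin in cycle `t` when `X n` is the desired transmitter: the total power
received from the other base stations of the `i`-th sector. -/
def interference (i : Fin M) (t n : ℕ) (ω : Ω) : ℝ≥0∞ :=
  ∑' m : ℕ, if m ≠ n ∧ X m ω ∈ sector M i then rxPower p X F t m ω else 0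

/-- Signal to interference plus noise ratio of `X n`, seen as a member of the `i`-th sector. -/
def sinr (i : Fin M) (t n : ℕ) (ω : Ω) : ℝ≥0∞ :=
  rxPower p X F t n ω /
    (interference p X F M i t n ω + ENNReal.ofReal (p.W / (p.P * M)))

/-- The `i`-th sector is detected in cycle `t`: the nearest base station in it has a signal to
interference plus noise ratio above the threshold. -/
def SectorDetected (i : Fin M) (t : ℕ) (ω : Ω) : Prop :=
  ∃ n, IsNearest X M i n ω ∧ ENNReal.ofReal p.Gam < sinr p X F M i t n ω

/-- Cell search succeeds in cycle `t`: at least one sector is detected. -/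
def CellSearchSuccess (t : ℕ) (ω : Ω) : Prop :=
  ∃ i : Fin M, SectorDetected p X F M i t ω

/-- The number of cycles needed for cell search, `inf {t ≥ 1 : cycle t succeeds}`, which is `∞`
when no cycle succeeds. -/
def numCycles (ω : Ω) : ℝ≥0∞ :=
  ⨅ (t : ℕ) (_ : 1 ≤ t ∧ CellSearchSuccess p X F M t ω), (t : ℝ≥0∞)

/-- The event that the `i`-th sector is detected in none of the first `j` cycles `1, …, j`. -/
def undetected (i : Fin M) (j : ℕ) : Set Ω :=
  {ω | ∀ t : ℕ, 1 ≤ t → t ≤ j → ¬ SectorDetected p X F M i t ω}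

/-- The sigma-algebra generated by the nearest distances `R_1, …, R_M`. -/
abbrev distSigma : MeasurableSpace Ω :=
  MeasurableSpace.comap (nearestDist X M) inferInstance

end Model

end CellSearch

end

/-! Freeze the configuration of base stations. The only randomness left is the fading, and detection
of sector `i` in a cycle means that an exponential variable exceeds an independent threshold made of
noise and interference. Its probability is therefore a Laplace transform, `D_i = exp (-W Γ l(R_i) /
(P M)) * ∏ 1 / (1 + Γ l(R_i) / l(‖x‖))`, the product running over the other points of the sector
(`measure_sectorDetected`). Different sectors or different cycles use disjoint sets of fading
variables, so the probability that each sector `i` stays undetected for `j_i` cycles is `∏ (1 - D_i)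
^ j_i` (`measure_iInter_undetected`).

It remains to average over the configuration given the distances `R_i`. The cycles share the same
interferers and are not treated as independent given the distances alone: the whole power is
expanded by the binomial theorem, which calls for the conditional mixed moments of the `D_i`. Since
`D_i ^ k` is the exponential of minus a sum over the points farther than `R_i`, its conditional mean
is a Laplace functional of the Poisson process restricted to those points, and it factors over the
disjoint sectors (`integral_prod_detProb_pow`). This gives `∏ f_{j_i}(R_i)`.

The required conditional law, that the points beyond the nearest ones are distributed as without
conditioning, is obtained without a Palm formula. The Laplace functional (`integral_expNeg_tsum`)
gives independence over disjoint regions. The distances are localized in cells of a grid, only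
points beyond the outer end of each cell are tested, and the mesh tends to zero
(`setIntegral_prod_expNeg_of_le`).

Taking a single nonzero `j_i` yields the first claim. For the second, `L = ∑_j 1{the first j cycles
fail}`, and the terms with all `j_i = j` are summed by Tonelli's theorem. -/

noncomputable section

namespace CellSearch

open MeasureTheory ProbabilityTheory Filter Topology

/-! ### The exponential of minus an extended nonnegative number -/

/-- The map `x ↦ exp (-x)` on `[0, ∞]`, with `exp (-∞) = 0`. -/
def expNeg (x : ℝ≥0∞) : ℝ := (EReal.exp (-(x : EReal))).toReal

lemma exp_neg_coe_ne_top (x : ℝ≥0∞) : EReal.exp (-(x : EReal)) ≠ ∞ := by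
  simp [(EReal.bot_lt_coe_ennreal x).ne']

lemma expNeg_nonneg (x : ℝ≥0∞) : 0 ≤ expNeg x := ENNReal.toReal_nonneg

lemma expNeg_le_one (x : ℝ≥0∞) : expNeg x ≤ 1 := by
  refine ENNReal.toReal_le_of_le_ofReal zero_le_one ?_
  simpa using EReal.coe_ennreal_nonneg x

@[simp] lemma expNeg_zero : expNeg 0 = 1 := by simp [expNeg]

@[simp] lemma expNeg_top : expNeg ∞ = 0 := by simp [expNeg]

lemma expNeg_ofReal {x : ℝ} (hx : 0 ≤ x) : expNeg (ENNReal.ofReal x) = Real.exp (-x) := by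
  rw [expNeg, EReal.coe_ennreal_ofReal, max_eq_left hx, ← EReal.coe_neg, EReal.exp_coe,
    ENNReal.toReal_ofReal (Real.exp_nonneg _)]

lemma expNeg_add (x y : ℝ≥0∞) : expNeg (x + y) = expNeg x * expNeg y := by
  rw [expNeg, expNeg, expNeg, ← ENNReal.toReal_mul, ← EReal.exp_add, EReal.coe_ennreal_add,
    EReal.neg_add (by simp) (by simp), sub_eq_add_neg]

lemma expNeg_sum {ι : Type*} (s : Finset ι) (g : ι → ℝ≥0∞) :
    expNeg (∑ i ∈ s, g i) = ∏ i ∈ s, expNeg (g i) := by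
  classical
  induction s using Finset.induction_on with
  | empty => simp
  | insert a s ha ih => rw [Finset.sum_insert ha, Finset.prod_insert ha, expNeg_add, ih]

lemma expNeg_nsmul (n : ℕ) (x : ℝ≥0∞) : expNeg (n * x) = expNeg x ^ n := by
  simpa using expNeg_sum (Finset.range n) fun _ => x

lemma continuous_expNeg : Continuous expNeg := by
  refine ENNReal.continuousOn_toReal.comp_continuous ?_ fun x => exp_neg_coe_ne_top x
  exact ENNReal.continuous_exp.comp (continuous_neg.comp continuous_coe_ennreal_ereal)

lemma measurable_expNeg : Measurable expNeg := continuous_expNeg.measurable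

lemma antitone_expNeg : Antitone expNeg := by
  intro x y h
  refine ENNReal.toReal_mono (exp_neg_coe_ne_top x) (EReal.exp_monotone ?_)
  exact EReal.neg_le_neg_iff.2 (by exact_mod_cast h)

lemma integrable_of_unit_bounds {Ω : Type*} [MeasurableSpace Ω] {μ : Measure Ω}
    [IsFiniteMeasure μ] {g : Ω → ℝ} (hg : Measurable g) (h0 : ∀ ω, 0 ≤ g ω) (h1 : ∀ ω, g ω ≤ 1) :
    Integrable g μ :=
  Integrable.of_bound hg.aestronglyMeasurable 1
    (.of_forall fun ω => by rw [Real.norm_of_nonneg (h0 ω)]; exact h1 ω)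

/-- This is the generating function of the Poisson law at `exp (-c)`. The value `c = ∞` is included
and gives the void probability, because `∞ * 0 = 0`. -/
lemma integral_expNeg_poisson (r : NNReal) (c : ℝ≥0∞) :
    ∫ n : ℕ, expNeg (c * (n : ℝ≥0∞)) ∂(poissonMeasure r) =
      expNeg (r * ENNReal.ofReal (1 - expNeg c)) := by
  rw [integral_poissonMeasure]
  have h1 : ∀ n : ℕ, expNeg (c * (n : ℝ≥0∞)) = expNeg c ^ n := fun n => by
    rw [mul_comm, expNeg_nsmul]
  have h2 : (r : ℝ≥0∞) = ENNReal.ofReal (r : ℝ) := by simp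
  rw [h2, ← ENNReal.ofReal_mul r.coe_nonneg,
    expNeg_ofReal (mul_nonneg r.coe_nonneg (sub_nonneg.2 (expNeg_le_one c)))]
  have h3 : HasSum (fun n : ℕ => ((r : ℝ) * expNeg c) ^ n / (n.factorial : ℝ))
      (Real.exp (r * expNeg c)) := by
    rw [Real.exp_eq_exp_ℝ]
    exact NormedSpace.expSeries_div_hasSum_exp _
  have h4 := (h3.mul_left (Real.exp (-(r : ℝ)))).tsum_eq
  rw [← Real.exp_add] at h4
  rw [show -((r : ℝ) * (1 - expNeg c)) = -r + r * expNeg c by ring, ← h4]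
  refine tsum_congr fun n => ?_
  rw [h1, smul_eq_mul, mul_pow]
  ring

/-! ### The Laplace functional of a Poisson process -/

section PointProcess

variable {Ω : Type*} [MeasurableSpace Ω] {μ : Measure Ω} [IsProbabilityMeasure μ]
  {Φ : Ω → Set ℂ} {lam : ℝ}

/-- The alternative `c = 0` is needed because the zero fibre of a simple function usually has
infinite area, where the Poisson law is not postulated. -/
lemma IsHomogeneousPPP.integral_expNeg_count (hΦ : IsHomogeneousPPP Φ lam μ) (hlam : 0 ≤ lam)
    {B : Set ℂ} (hB : MeasurableSet B) {c : ℝ≥0∞} (h : c = 0 ∨ volume B < ∞) :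
    ∫ ω, expNeg (c * ((Φ ω ∩ B).encard : ℝ≥0∞)) ∂μ =
      expNeg (ENNReal.ofReal lam * (volume B * ENNReal.ofReal (1 - expNeg c))) := by
  rcases h with rfl | h
  · simp
  have h1 : ∫ ω, expNeg (c * ((Φ ω ∩ B).encard : ℝ≥0∞)) ∂μ =
      ∫ n, expNeg (c * ((n : ℕ∞) : ℝ≥0∞)) ∂(μ.map fun ω => (Φ ω ∩ B).encard) := by
    rw [integral_map (hΦ.measurable_count B hB).aemeasurable]
    exact Measurable.of_discrete.aestronglyMeasurable
  rw [h1, hΦ.count_law B hB h, integral_map .of_discrete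
    Measurable.of_discrete.aestronglyMeasurable]
  simp only [ENat.toENNReal_coe]
  rw [integral_expNeg_poisson, ← mul_assoc]
  congr 2
  change ENNReal.ofReal _ = _
  rw [ENNReal.ofReal_mul hlam, ENNReal.ofReal_toReal h.ne]

/-- The Laplace functional for simple functions. -/
lemma IsHomogeneousPPP.integral_expNeg_simpleFunc (hΦ : IsHomogeneousPPP Φ lam μ)
    (hlam : 0 ≤ lam) (g : SimpleFunc ℂ ℝ≥0∞)
    (hv : ∀ c, c ≠ 0 → volume (g ⁻¹' {c}) < ∞) :
    ∫ ω, expNeg (∑ c ∈ g.range, c * ((Φ ω ∩ g ⁻¹' {c}).encard : ℝ≥0∞)) ∂μ =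
      expNeg (ENNReal.ofReal lam * ∫⁻ z, ENNReal.ofReal (1 - expNeg (g z))) := by
  classical
  -- Independence of counts is postulated for families indexed by `Fin n`, so the values of `g` are
  -- enumerated; fibres of distinct values are disjoint.
  let e := g.range.equivFin
  have hind := hΦ.count_indep g.range.card (fun k => g ⁻¹' {((e.symm k : g.range) : ℝ≥0∞)})
    (fun k => g.measurableSet_fiber _) (by
      intro k l hkl
      refine Disjoint.preimage _ ?_
      rw [Set.disjoint_singleton]
      exact fun h => hkl (e.symm.injective (Subtype.ext h)))
  have hsum : ∀ G : ℝ≥0∞ → ℝ≥0∞, ∑ c ∈ g.range, G c = ∑ k, G ((e.symm k : g.range) : ℝ≥0∞) := by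
    intro G
    rw [← Finset.sum_coe_sort, ← e.symm.sum_comp]
  have h1 := hind.integral_fun_prod_comp
    (f := fun k n => expNeg (((e.symm k : g.range) : ℝ≥0∞) * ((n : ℕ∞) : ℝ≥0∞)))
    (fun k => (hΦ.measurable_count _ (g.measurableSet_fiber _)).aemeasurable)
    (fun k => Measurable.of_discrete.aestronglyMeasurable)
  simp_rw [← expNeg_sum] at h1
  simp_rw [hsum, h1]
  have h2 : ∫⁻ z, ENNReal.ofReal (1 - expNeg (g z)) =
      ∑ c ∈ g.range, ENNReal.ofReal (1 - expNeg c) * volume (g ⁻¹' {c}) := by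
    rw [← SimpleFunc.map_lintegral, ← SimpleFunc.lintegral_eq_lintegral]
    rfl
  rw [h2, hsum, Finset.mul_sum, expNeg_sum]
  refine Finset.prod_congr rfl fun k _ => ?_
  rw [hΦ.integral_expNeg_count hlam (g.measurableSet_fiber _), mul_comm (volume _)]
  by_cases hk : ((e.symm k : g.range) : ℝ≥0∞) = 0
  · exact Or.inl hk
  · exact Or.inr (hv _ hk)

end PointProcess

section Enumerated

variable {Ω : Type*} [MeasurableSpace Ω] {μ : Measure Ω} [IsProbabilityMeasure μ]
  {X : ℕ → Ω → ℂ} {lam : ℝ}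

lemma tsum_indicator_eq_encard {x : ℕ → ℂ} (hx : Function.Injective x) (B : Set ℂ) :
    ∑' n, B.indicator (fun _ => (1 : ℝ≥0∞)) (x n) = ((Set.range x ∩ B).encard : ℝ≥0∞) := by
  have h : ∀ n, B.indicator (fun _ => (1 : ℝ≥0∞)) (x n) =
      (x ⁻¹' B).indicator (fun _ => (1 : ℝ≥0∞)) n := fun n => rfl
  simp_rw [h]
  rw [← tsum_subtype, ENNReal.tsum_set_one, Set.inter_comm, ← Set.image_preimage_eq_inter_range,
    hx.encard_image]

/-- Injectivity turns sums over indices into counts of points, the only quantities about which the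
Poisson hypothesis speaks. -/
lemma tsum_simpleFunc_comp {x : ℕ → ℂ} (hx : Function.Injective x) (g : SimpleFunc ℂ ℝ≥0∞) :
    ∑' n, g (x n) = ∑ c ∈ g.range, c * ((Set.range x ∩ g ⁻¹' {c}).encard : ℝ≥0∞) := by
  classical
  have h : ∀ n, g (x n) =
      ∑ c ∈ g.range, c * (g ⁻¹' {c}).indicator (fun _ => (1 : ℝ≥0∞)) (x n) := by
    intro n
    rw [Finset.sum_eq_single (g (x n))]
    · simp
    · intro c _ hc
      rw [Set.indicator_of_notMem, mul_zero]
      simpa using hc.symm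
    · intro h
      exact absurd (g.mem_range_self _) h
  simp_rw [h]
  rw [Summable.tsum_finsetSum fun _ _ => ENNReal.summable]
  refine Finset.sum_congr rfl fun c _ => ?_
  rw [ENNReal.tsum_mul_left, tsum_indicator_eq_encard hx]

/-- The Laplace functional of a homogeneous Poisson point process. -/
theorem integral_expNeg_tsum (hX : ∀ n, Measurable (X n))
    (hinj : ∀ᵐ ω ∂μ, Function.Injective fun n => X n ω)
    (hΦ : IsHomogeneousPPP (fun ω => Set.range fun n => X n ω) lam μ) (hlam : 0 ≤ lam)
    {u : ℂ → ℝ≥0∞} (hu : Measurable u) :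
    ∫ ω, expNeg (∑' n, u (X n ω)) ∂μ =
      expNeg (ENNReal.ofReal lam * ∫⁻ z, ENNReal.ofReal (1 - expNeg (u z))) := by
  -- Cutting off outside a ball gives every nonzero fibre finite area while keeping the
  -- approximation monotone.
  let g : ℕ → SimpleFunc ℂ ℝ≥0∞ := fun m =>
    (SimpleFunc.eapprox u m).restrict (Metric.closedBall 0 m)
  have hgapp : ∀ m z, g m z =
      (Metric.closedBall (0 : ℂ) m).indicator (SimpleFunc.eapprox u m) z := fun m z =>
    SimpleFunc.restrict_apply _ measurableSet_closedBall z
  have hmono : ∀ z, Monotone fun m => g m z := by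
    intro z m k hmk
    simp only [hgapp]
    refine (Set.indicator_le_indicator (SimpleFunc.monotone_eapprox u hmk z)).trans ?_
    exact Set.indicator_le_indicator_of_subset
      (Metric.closedBall_subset_closedBall (by exact_mod_cast hmk)) (fun _ => bot_le) z
  have hlim : ∀ z, Tendsto (fun m => g m z) atTop (𝓝 (u z)) := by
    intro z
    refine (SimpleFunc.tendsto_eapprox hu z).congr' ?_
    filter_upwards [eventually_ge_atTop ⌈‖z‖⌉₊] with m hm
    rw [hgapp, Set.indicator_of_mem]
    simpa using Nat.ceil_le.1 hm
  have hvol : ∀ m c, c ≠ 0 → volume (g m ⁻¹' {c}) < ∞ := by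
    intro m c hc
    refine (measure_mono ?_).trans_lt (measure_closedBall_lt_top (x := (0 : ℂ)) (r := m))
    intro z hz
    by_contra hz'
    refine hc ?_
    rw [← show g m z = c from hz, hgapp, Set.indicator_of_notMem hz']
  have hL : ∀ m, ∫ ω, expNeg (∑' n, g m (X n ω)) ∂μ =
      expNeg (ENNReal.ofReal lam * ∫⁻ z, ENNReal.ofReal (1 - expNeg (g m z))) := by
    intro m
    rw [← hΦ.integral_expNeg_simpleFunc hlam (g m) (hvol m)]
    refine integral_congr_ae ?_
    filter_upwards [hinj] with ω hω
    rw [tsum_simpleFunc_comp hω]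
  have h1 : Tendsto (fun m => ∫ ω, expNeg (∑' n, g m (X n ω)) ∂μ) atTop
      (𝓝 (∫ ω, expNeg (∑' n, u (X n ω)) ∂μ)) := by
    refine tendsto_integral_of_dominated_convergence (fun _ => 1) (fun m => ?_)
      (integrable_const _) (fun m => .of_forall fun ω => ?_) (.of_forall fun ω => ?_)
    · exact (measurable_expNeg.comp
        (Measurable.tsum fun n => (g m).measurable.comp (hX n))).aestronglyMeasurable
    · rw [Real.norm_of_nonneg (expNeg_nonneg _)]
      exact expNeg_le_one _
    · refine (continuous_expNeg.tendsto _).comp ?_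
      -- A series is an integral for the counting measure, so monotone convergence applies even when
      -- the limit is infinite.
      have := lintegral_tendsto_of_tendsto_of_monotone (μ := Measure.count)
        (f := fun m n => g m (X n ω)) (F := fun n => u (X n ω))
        (fun m => Measurable.of_discrete.aemeasurable)
        (.of_forall fun n => hmono _) (.of_forall fun n => hlim _)
      simpa [lintegral_count] using this
  have h2 : Tendsto (fun m => expNeg (ENNReal.ofReal lam *
      ∫⁻ z, ENNReal.ofReal (1 - expNeg (g m z)))) atTop
      (𝓝 (expNeg (ENNReal.ofReal lam * ∫⁻ z, ENNReal.ofReal (1 - expNeg (u z))))) := by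
    refine (continuous_expNeg.tendsto _).comp (ENNReal.Tendsto.const_mul ?_
      (Or.inr ENNReal.ofReal_ne_top))
    refine lintegral_tendsto_of_tendsto_of_monotone (fun m => ?_) (.of_forall fun z => ?_)
      (.of_forall fun z => ?_)
    · exact (ENNReal.measurable_ofReal.comp (measurable_const.sub
        (measurable_expNeg.comp (g m).measurable))).aemeasurable
    · intro m k hmk
      exact ENNReal.ofReal_le_ofReal (sub_le_sub_left (antitone_expNeg (hmono z hmk)) _)
    · exact (ENNReal.continuous_ofReal.tendsto _).comp
        (tendsto_const_nhds.sub ((continuous_expNeg.tendsto _).comp (hlim z)))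
  exact tendsto_nhds_unique h1 (by simpa only [hL] using h2)

end Enumerated

/-! ### Sectors and polar coordinates -/

section Geometry

lemma toIcoMod_two_pi_of_nonneg {t : ℝ} (h0 : 0 ≤ t) (h1 : t < Real.pi) :
    toIcoMod Real.two_pi_pos 0 t = t := by
  rw [toIcoMod_eq_self]
  constructor <;> linarith [Real.pi_pos]

lemma toIcoMod_two_pi_of_neg {t : ℝ} (h0 : t < 0) (h1 : -Real.pi ≤ t) :
    toIcoMod Real.two_pi_pos 0 t = t + 2 * Real.pi := by
  rw [← toIcoMod_add_right, toIcoMod_eq_self]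
  constructor <;> linarith [Real.pi_pos]

lemma measurable_toIcoMod_two_pi : Measurable fun t : ℝ => toIcoMod Real.two_pi_pos 0 t := by
  simp_rw [toIcoMod_eq_add_fract_mul]
  fun_prop

lemma measurable_angle : Measurable angle :=
  measurable_toIcoMod_two_pi.comp Complex.measurable_arg

lemma measurableSet_sector (M : ℕ) (i : Fin M) : MeasurableSet (sector M i) :=
  (measurableSet_singleton (0 : ℂ)).compl.inter (measurable_angle measurableSet_Ico)

lemma pairwise_disjoint_sector (M : ℕ) {i j : Fin M} (h : i ≠ j) :
    Disjoint (sector M i) (sector M j) := by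
  rw [Set.disjoint_left]
  rintro z ⟨-, h1, h2⟩ ⟨-, h3, h4⟩
  have hM : (0 : ℝ) < M := by exact_mod_cast i.pos
  have key : ∀ a b : ℕ, 2 * Real.pi * (a : ℝ) / M ≤ angle z →
      angle z < 2 * Real.pi * ((b : ℝ) + 1) / M → a ≤ b := by
    intro a b ha hb
    have h5 := ha.trans_lt hb
    rw [div_lt_div_iff_of_pos_right hM] at h5
    have h6 := lt_of_mul_lt_mul_left h5 Real.two_pi_pos.le
    exact Nat.lt_succ_iff.1 (by exact_mod_cast h6)
  exact h (Fin.ext (le_antisymm (key _ _ h1 h4) (key _ _ h3 h2)))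

/-- Polar coordinates take angles in `(-π, π)`, sectors in `[0, 2π)`. The interval is cut at `π`;
the part below stays and the part above is translated by `-2π`, which preserves length. -/
lemma volume_toIcoMod_preimage {a b : ℝ} (ha : 0 ≤ a) (hb : b ≤ 2 * Real.pi) :
    volume (Set.Ioo (-Real.pi) Real.pi ∩
      (fun t => toIcoMod Real.two_pi_pos 0 t) ⁻¹' Set.Ico a b) = ENNReal.ofReal (b - a) := by
  have h1 : Set.Ico (-Real.pi) Real.pi ∩
      (fun t => toIcoMod Real.two_pi_pos 0 t) ⁻¹' Set.Ico a b =
      (Set.Ico a b ∩ Set.Iio Real.pi) ∪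
        (fun t => t + 2 * Real.pi) ⁻¹' (Set.Ico a b \ Set.Iio Real.pi) := by
    ext t
    simp only [Set.mem_inter_iff, Set.mem_Ico, Set.mem_preimage, Set.mem_union, Set.mem_Iio,
      Set.mem_sdiff, not_lt]
    rcases lt_or_ge t 0 with ht | ht
    · constructor
      · rintro ⟨⟨h2, h3⟩, h4⟩
        rw [toIcoMod_two_pi_of_neg ht h2] at h4
        exact Or.inr ⟨h4, by linarith⟩
      · rintro (⟨h2, h3⟩ | ⟨h2, h3⟩)
        · linarith
        · have h4 : -Real.pi ≤ t := by linarith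
          rw [toIcoMod_two_pi_of_neg ht h4]
          exact ⟨⟨h4, by linarith [Real.pi_pos]⟩, h2⟩
    · constructor
      · rintro ⟨⟨h2, h3⟩, h4⟩
        rw [toIcoMod_two_pi_of_nonneg ht h3] at h4
        exact Or.inl ⟨h4, h3⟩
      · rintro (⟨h2, h3⟩ | ⟨h2, h3⟩)
        · rw [toIcoMod_two_pi_of_nonneg ht h3]
          exact ⟨⟨by linarith [Real.pi_pos], h3⟩, h2⟩
        · linarith
  have h0 : (Set.Ioo (-Real.pi) Real.pi ∩
      (fun t => toIcoMod Real.two_pi_pos 0 t) ⁻¹' Set.Ico a b : Set ℝ) =ᵐ[volume]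
      (Set.Ico (-Real.pi) Real.pi ∩ (fun t => toIcoMod Real.two_pi_pos 0 t) ⁻¹' Set.Ico a b :
        Set ℝ) := Ioo_ae_eq_Ico.inter (ae_eq_refl _)
  rw [measure_congr h0, h1, measure_union,
    measure_preimage_add_right, measure_inter_add_sdiff _ measurableSet_Iio, Real.volume_Ico]
  · rw [Set.disjoint_left]
    simp only [Set.mem_inter_iff, Set.mem_Ico, Set.mem_preimage, Set.mem_Iio, Set.mem_sdiff, not_lt]
    rintro t ⟨⟨h2, h3⟩, h4⟩ ⟨⟨h5, h6⟩, h7⟩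
    linarith
  · exact measurable_id.add_const _ (measurableSet_Ico.diff measurableSet_Iio)

lemma polarCoord_symm_mem_sector {M : ℕ} {i : Fin M} {q : ℝ × ℝ}
    (hq : q ∈ polarCoord.target) : Complex.polarCoord.symm q ∈ sector M i ↔
      q.2 ∈ (fun t => toIcoMod Real.two_pi_pos 0 t) ⁻¹'
        Set.Ico (2 * Real.pi * ((i : ℕ) : ℝ) / M) (2 * Real.pi * (((i : ℕ) : ℝ) + 1) / M) := by
  have h1 := Complex.polarCoord.right_inv hq
  rw [Complex.polarCoord_apply] at h1
  have h2 : ‖Complex.polarCoord.symm q‖ = q.1 := congrArg Prod.fst h1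
  have h3 : Complex.arg (Complex.polarCoord.symm q) = q.2 := congrArg Prod.snd h1
  have h4 : Complex.polarCoord.symm q ≠ 0 := by
    rw [← norm_pos_iff, h2]
    exact hq.1
  simp only [sector, Set.mem_ofPred_eq, angle, h3, Set.mem_preimage, ne_eq, h4, not_false_eq_true,
    true_and]

/-- Integration in polar coordinates of a radial function over a sector. -/
lemma lintegral_sector (M : ℕ) (i : Fin M) {g : ℝ → ℝ≥0∞} (hg : Measurable g) :
    ∫⁻ z, (sector M i).indicator (fun z => g ‖z‖) z =
      ENNReal.ofReal (2 * Real.pi / M) * ∫⁻ s in Set.Ioi (0 : ℝ), g s * ENNReal.ofReal s := by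
  have hM : (0 : ℝ) < M := by exact_mod_cast i.pos
  set Θ : Set ℝ := (fun t => toIcoMod Real.two_pi_pos 0 t) ⁻¹'
    Set.Ico (2 * Real.pi * ((i : ℕ) : ℝ) / M) (2 * Real.pi * (((i : ℕ) : ℝ) + 1) / M) with hΘ
  have hΘm : MeasurableSet Θ := measurable_toIcoMod_two_pi measurableSet_Ico
  rw [← Complex.lintegral_comp_polarCoord_symm]
  have h1 : ∀ q ∈ polarCoord.target, ENNReal.ofReal q.1 •
      (sector M i).indicator (fun z => g ‖z‖) (Complex.polarCoord.symm q) =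
      (g q.1 * ENNReal.ofReal q.1) * Θ.indicator (fun _ => 1) q.2 := by
    intro q hq
    by_cases h : q.2 ∈ Θ
    · rw [Set.indicator_of_mem ((polarCoord_symm_mem_sector hq).2 h), Set.indicator_of_mem h,
        Complex.norm_polarCoord_symm, abs_of_pos hq.1, mul_one, smul_eq_mul, mul_comm]
    · rw [Set.indicator_of_notMem (fun h' => h ((polarCoord_symm_mem_sector hq).1 h')),
        Set.indicator_of_notMem h, smul_zero, mul_zero]
  rw [setLIntegral_congr_fun polarCoord.open_target.measurableSet h1, polarCoord_target,
    Measure.volume_eq_prod, ← Measure.prod_restrict,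
    lintegral_prod_mul (f := fun s => g s * ENNReal.ofReal s)
      (hg.mul ENNReal.measurable_ofReal).aemeasurable
      (measurable_const.indicator hΘm).aemeasurable,
    lintegral_indicator hΘm, setLIntegral_const, Measure.restrict_apply hΘm, one_mul, mul_comm,
    Set.inter_comm Θ, hΘ, volume_toIcoMod_preimage]
  · congr 2
    field_simp
    ring
  · positivity
  · rw [div_le_iff₀ hM]
    have : (((i : ℕ) : ℝ) + 1) ≤ M := by exact_mod_cast i.isLt
    nlinarith [Real.pi_pos]

end Geometry

/-! ### Sector sums and nearest distances of a configuration -/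

/-- The sum of `v ‖z‖` over the points `z` of the configuration `x` in the `i`-th sector. -/
def sectorSum (M : ℕ) (i : Fin M) (v : ℝ → ℝ≥0∞) (x : ℕ → ℂ) : ℝ≥0∞ :=
  ∑' n, (sector M i).indicator (fun z => v ‖z‖) (x n)

/-- The distance from the origin to the nearest point of the configuration in a sector. -/
def minDist (M : ℕ) (i : Fin M) (x : ℕ → ℂ) : ℝ :=
  sInf {r : ℝ | ∃ n, x n ∈ sector M i ∧ r = ‖x n‖}

lemma nearestDist_eq {Ω : Type*} (X : ℕ → Ω → ℂ) (M : ℕ) (ω : Ω) (i : Fin M) :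
    nearestDist X M ω i = minDist M i fun n => X n ω := rfl

lemma measurable_indicator_norm {M : ℕ} {i : Fin M} {v : ℝ → ℝ≥0∞} (hv : Measurable v) :
    Measurable ((sector M i).indicator fun z => v ‖z‖) :=
  (hv.comp measurable_norm).indicator (measurableSet_sector M i)

lemma measurable_sectorSum {M : ℕ} {i : Fin M} {v : ℝ → ℝ≥0∞} (hv : Measurable v) :
    Measurable (sectorSum M i v) :=
  Measurable.tsum fun n => (measurable_indicator_norm hv).comp (measurable_pi_apply n)

lemma sectorSum_add {M : ℕ} {i : Fin M} (v w : ℝ → ℝ≥0∞) (x : ℕ → ℂ) :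
    sectorSum M i (fun s => v s + w s) x = sectorSum M i v x + sectorSum M i w x := by
  rw [sectorSum, sectorSum, sectorSum, ← ENNReal.tsum_add]
  refine tsum_congr fun n => ?_
  exact congrFun (Set.indicator_add _ _ _) _

lemma minDist_nonneg (M : ℕ) (i : Fin M) (x : ℕ → ℂ) : 0 ≤ minDist M i x := by
  refine Real.sInf_nonneg ?_
  rintro r ⟨n, -, rfl⟩
  exact norm_nonneg _

lemma bddBelow_norms (M : ℕ) (i : Fin M) (x : ℕ → ℂ) :
    BddBelow {r : ℝ | ∃ n, x n ∈ sector M i ∧ r = ‖x n‖} :=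
  ⟨0, by rintro r ⟨n, -, rfl⟩; exact norm_nonneg _⟩

/-- A sector without points has `minDist = 0`, the value of `sInf ∅`. Such configurations therefore
belong to every sublevel set with `a > 0`, and form the first set of the union. -/
lemma measurable_minDist (M : ℕ) (i : Fin M) : Measurable (minDist M i) := by
  have hm : ∀ n, MeasurableSet {x : ℕ → ℂ | x n ∈ sector M i} := fun n =>
    measurable_pi_apply n (measurableSet_sector M i)
  refine measurable_of_Iio fun a => ?_
  rcases le_or_gt a 0 with ha | ha
  · convert! MeasurableSet.empty
    ext x
    simpa using ha.trans (minDist_nonneg M i x)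
  · have : minDist M i ⁻¹' Set.Iio a = (⋂ n, {x : ℕ → ℂ | x n ∈ sector M i}ᶜ) ∪
        ⋃ n, {x : ℕ → ℂ | x n ∈ sector M i} ∩ {x | ‖x n‖ < a} := by
      ext x
      simp only [Set.mem_preimage, Set.mem_Iio, Set.mem_union, Set.mem_iInter, Set.mem_compl_iff,
        Set.mem_iUnion, Set.mem_inter_iff, Set.mem_ofPred_eq]
      by_cases h : ∃ n, x n ∈ sector M i
      · obtain ⟨n, hn⟩ := h
        rw [minDist, csInf_lt_iff (bddBelow_norms M i x) ⟨_, n, hn, rfl⟩]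
        constructor
        · rintro ⟨b, ⟨m, hm, rfl⟩, hb⟩
          exact Or.inr ⟨m, hm, hb⟩
        · rintro (h | ⟨m, hm, hb⟩)
          · exact absurd hn (h n)
          · exact ⟨_, ⟨m, hm, rfl⟩, hb⟩
      · push Not at h
        simp [minDist, ha, h]
    rw [this]
    exact (MeasurableSet.iInter fun n => (hm n).compl).union (MeasurableSet.iUnion fun n =>
      (hm n).inter (measurableSet_lt (measurable_pi_apply n).norm measurable_const))

/-- In every sector, exactly one point of the configuration is nearest to the origin. -/
def Regular (M : ℕ) (x : ℕ → ℂ) : Prop :=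
  Function.Injective x ∧ ∀ i : Fin M, ∃ n, x n ∈ sector M i ∧
    ∀ m, x m ∈ sector M i → m ≠ n → ‖x n‖ < ‖x m‖

lemma minDist_eq_of_nearest {M : ℕ} {i : Fin M} {x : ℕ → ℂ} {n : ℕ} (hn : x n ∈ sector M i)
    (h : ∀ m, x m ∈ sector M i → m ≠ n → ‖x n‖ < ‖x m‖) : minDist M i x = ‖x n‖ := by
  refine le_antisymm (csInf_le (bddBelow_norms M i x) ⟨n, hn, rfl⟩)
    (le_csInf ⟨_, n, hn, rfl⟩ ?_)
  rintro r ⟨m, hm, rfl⟩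
  by_cases hmn : m = n
  · rw [hmn]
  · exact (h m hm hmn).le

lemma Regular.minDist_pos {M : ℕ} {x : ℕ → ℂ} (h : Regular M x) (i : Fin M) :
    0 < minDist M i x := by
  obtain ⟨n, hn, hn'⟩ := h.2 i
  rw [minDist_eq_of_nearest hn hn']
  exact norm_pos_iff.2 hn.1

/-- `minDist` is at least `a` if and only if the sector has no point at distance less than `a`. -/
lemma Regular.expNeg_sectorSum_top {M : ℕ} {x : ℕ → ℂ} (h : Regular M x) (i : Fin M) (a : ℝ) :
    expNeg (sectorSum M i ((Set.Iio a).indicator fun _ => ∞) x) =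
      (Set.Ici a).indicator (fun _ => (1 : ℝ)) (minDist M i x) := by
  obtain ⟨n, hn, hn'⟩ := h.2 i
  rw [minDist_eq_of_nearest hn hn']
  by_cases ha : a ≤ ‖x n‖
  · have h0 : sectorSum M i ((Set.Iio a).indicator fun _ => ∞) x = 0 := by
      refine ENNReal.tsum_eq_zero.2 fun m => ?_
      by_cases hm : x m ∈ sector M i
      · rw [Set.indicator_of_mem hm, Set.indicator_of_notMem]
        rw [Set.mem_Iio, not_lt]
        by_cases hmn : m = n
        · rwa [hmn]
        · exact ha.trans (hn' m hm hmn).le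
      · rw [Set.indicator_of_notMem hm]
    rw [h0, expNeg_zero, Set.indicator_of_mem (Set.mem_Ici.2 ha)]
  · have h0 : sectorSum M i ((Set.Iio a).indicator fun _ => ∞) x = ∞ := by
      refine ENNReal.tsum_eq_top_of_eq_top ⟨n, ?_⟩
      rw [Set.indicator_of_mem hn, Set.indicator_of_mem (Set.mem_Iio.2 (not_le.1 ha))]
    rw [h0, expNeg_top, Set.indicator_of_notMem (by simpa using ha)]

/-! ### Poisson sums over sectors and almost sure regularity -/

section Random

variable {Ω : Type*} [MeasurableSpace Ω] {μ : Measure Ω} [IsProbabilityMeasure μ]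
  {X : ℕ → Ω → ℂ} {lam : ℝ}

lemma sum_indicator_sector {M : ℕ} {β : Type*} [AddCommMonoid β] (w : Fin M → ℂ → β) {z : ℂ}
    {i : Fin M} (hz : z ∈ sector M i) : ∑ j, (sector M j).indicator (w j) z = w i z := by
  rw [Finset.sum_eq_single i]
  · exact Set.indicator_of_mem hz _
  · intro j _ hj
    exact Set.indicator_of_notMem
      (fun hzj => Set.disjoint_left.1 (pairwise_disjoint_sector M hj) hzj hz) _
  · simp

/-- The sectors are disjoint, so at most one summand is nonzero, and `1 - exp (-0) = 0` for the
others. This is the source of independence between sectors. -/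
lemma ofReal_one_sub_expNeg_sum {M : ℕ} (v : Fin M → ℝ → ℝ≥0∞) (z : ℂ) :
    ENNReal.ofReal (1 - expNeg (∑ i, (sector M i).indicator (fun z => v i ‖z‖) z)) =
      ∑ i, (sector M i).indicator (fun z => ENNReal.ofReal (1 - expNeg (v i ‖z‖))) z := by
  by_cases h : ∃ i : Fin M, z ∈ sector M i
  · obtain ⟨i, hi⟩ := h
    rw [sum_indicator_sector (fun i z => v i ‖z‖) hi,
      sum_indicator_sector (fun i z => ENNReal.ofReal (1 - expNeg (v i ‖z‖))) hi]
  · push Not at h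
    simp [h]

/-- The Laplace functional for functions which are radial in each sector. -/
theorem integral_prod_expNeg_sectorSum (hX : ∀ n, Measurable (X n))
    (hinj : ∀ᵐ ω ∂μ, Function.Injective fun n => X n ω)
    (hΦ : IsHomogeneousPPP (fun ω => Set.range fun n => X n ω) lam μ) (hlam : 0 ≤ lam) {M : ℕ}
    (v : Fin M → ℝ → ℝ≥0∞) (hv : ∀ i, Measurable (v i)) :
    ∫ ω, ∏ i, expNeg (sectorSum M i (v i) fun n => X n ω) ∂μ =
      ∏ i, expNeg (ENNReal.ofReal (2 * lam * Real.pi / M) *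
        ∫⁻ s in Set.Ioi (0 : ℝ), ENNReal.ofReal ((1 - expNeg (v i s)) * s)) := by
  have hmeas : Measurable fun z => ∑ i, (sector M i).indicator (fun z => v i ‖z‖) z :=
    Finset.measurable_fun_sum _ fun i _ => measurable_indicator_norm (hv i)
  have h : ∫ ω, expNeg (∑' n, ∑ i, (sector M i).indicator (fun z => v i ‖z‖) (X n ω)) ∂μ = _ :=
    integral_expNeg_tsum hX hinj hΦ hlam hmeas
  have h1 : ∀ ω, ∑' n, ∑ i, (sector M i).indicator (fun z => v i ‖z‖) (X n ω) =
      ∑ i, sectorSum M i (v i) fun n => X n ω := fun ω =>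
    Summable.tsum_finsetSum fun _ _ => ENNReal.summable
  have hone : ∀ i, Measurable fun s => ENNReal.ofReal (1 - expNeg (v i s)) := fun i =>
    ENNReal.measurable_ofReal.comp (measurable_const.sub (measurable_expNeg.comp (hv i)))
  simp_rw [h1, ofReal_one_sub_expNeg_sum, expNeg_sum] at h
  rw [h]
  rw [lintegral_finsetSum _ fun i _ => measurable_indicator_norm (hone i), Finset.mul_sum,
    expNeg_sum]
  refine Finset.prod_congr rfl fun i _ => ?_
  rw [lintegral_sector M i (hone i), ← mul_assoc, ← ENNReal.ofReal_mul hlam]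
  congr 2
  · congr 1
    ring
  · refine lintegral_congr fun s => ?_
    rw [ENNReal.ofReal_mul (sub_nonneg.2 (expNeg_le_one _))]

/-- The Laplace functional for a radial function in one sector. -/
theorem integral_expNeg_sectorSum (hX : ∀ n, Measurable (X n))
    (hinj : ∀ᵐ ω ∂μ, Function.Injective fun n => X n ω)
    (hΦ : IsHomogeneousPPP (fun ω => Set.range fun n => X n ω) lam μ) (hlam : 0 ≤ lam) {M : ℕ}
    (i : Fin M) {v : ℝ → ℝ≥0∞} (hv : Measurable v) :
    ∫ ω, expNeg (sectorSum M i v fun n => X n ω) ∂μ =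
      expNeg (ENNReal.ofReal (2 * lam * Real.pi / M) *
        ∫⁻ s in Set.Ioi (0 : ℝ), ENNReal.ofReal ((1 - expNeg (v s)) * s)) := by
  classical
  have h := integral_prod_expNeg_sectorSum hX hinj hΦ hlam
    (fun j => if j = i then v else fun _ => 0) (fun j => by split_ifs <;> fun_prop)
  have h0 : ∀ (j : Fin M) (x : ℕ → ℂ), expNeg (sectorSum M j
      (if j = i then v else fun _ => 0) x) = if j = i then expNeg (sectorSum M i v x) else 1 := by
    intro j x
    split_ifs with hj
    · rw [hj]
    · simp [sectorSum]
  have h1 : ∀ j : Fin M, expNeg (ENNReal.ofReal (2 * lam * Real.pi / M) *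
      ∫⁻ s in Set.Ioi (0 : ℝ),
        ENNReal.ofReal ((1 - expNeg ((if j = i then v else fun _ => 0) s)) * s)) =
      if j = i then expNeg (ENNReal.ofReal (2 * lam * Real.pi / M) *
      ∫⁻ s in Set.Ioi (0 : ℝ), ENNReal.ofReal ((1 - expNeg (v s)) * s)) else 1 := by
    intro j
    split_ifs with hj
    · rfl
    · simp
  simpa only [h0, h1, Finset.prod_ite_eq', Finset.mem_univ, if_true] using h

lemma lintegral_Ioi_ofReal : ∫⁻ s in Set.Ioi (0 : ℝ), ENNReal.ofReal s = ∞ := by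
  refine top_le_iff.1 ?_
  calc ∞ = ∫⁻ _ in Set.Ioi (1 : ℝ), (1 : ℝ≥0∞) := by simp
    _ ≤ ∫⁻ s in Set.Ioi (1 : ℝ), ENNReal.ofReal s := by
      refine setLIntegral_mono' measurableSet_Ioi fun s hs => ?_
      rw [← ENNReal.ofReal_one]
      exact ENNReal.ofReal_le_ofReal (le_of_lt hs)
    _ ≤ _ := lintegral_mono_set (Set.Ioi_subset_Ioi zero_le_one)

/-- The Laplace functional of the constant `∞` is the probability that the sector is empty; it
vanishes because the sector has infinite area. -/
lemma ae_exists_mem_sector (hX : ∀ n, Measurable (X n))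
    (hinj : ∀ᵐ ω ∂μ, Function.Injective fun n => X n ω)
    (hΦ : IsHomogeneousPPP (fun ω => Set.range fun n => X n ω) lam μ) (hlam : 0 < lam) {M : ℕ}
    (i : Fin M) : ∀ᵐ ω ∂μ, ∃ n, X n ω ∈ sector M i := by
  have hM : (0 : ℝ) < M := by exact_mod_cast i.pos
  have hpos : 0 < 2 * lam * Real.pi / M := by positivity
  have h := integral_expNeg_sectorSum hX hinj hΦ hlam.le i (v := fun _ => ∞) measurable_const
  simp only [expNeg_top, sub_zero, one_mul, lintegral_Ioi_ofReal] at h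
  rw [ENNReal.mul_top (by simpa using hpos), expNeg_top, integral_eq_zero_iff_of_nonneg
    (fun ω => expNeg_nonneg _)] at h
  · filter_upwards [h] with ω hω
    by_contra! hn
    have : sectorSum M i (fun _ => ∞) (fun n => X n ω) = 0 := by
      refine ENNReal.tsum_eq_zero.2 fun n => ?_
      rw [Set.indicator_of_notMem (hn n)]
    simp [this] at hω
  · exact integrable_of_unit_bounds (measurable_expNeg.comp ((measurable_sectorSum
      measurable_const).comp (measurable_pi_lambda _ hX))) (fun _ => expNeg_nonneg _)
      fun _ => expNeg_le_one _

omit [IsProbabilityMeasure μ] in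
lemma ae_encard_ne_top (hΦ : IsHomogeneousPPP (fun ω => Set.range fun n => X n ω) lam μ)
    {B : Set ℂ} (hB : MeasurableSet B) (hv : volume B < ∞) :
    ∀ᵐ ω ∂μ, ((Set.range fun n => X n ω) ∩ B).encard ≠ ⊤ := by
  have h := hΦ.count_law B hB hv
  have h1 : ∀ᵐ n ∂(μ.map fun ω => ((Set.range fun n => X n ω) ∩ B).encard), n ≠ ⊤ := by
    rw [h, ae_map_iff .of_discrete .of_discrete]
    exact .of_forall fun n => ENat.natCast_ne_top n
  exact ae_of_ae_map (hΦ.measurable_count B hB).aemeasurable h1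

/-- The probability is `1 - exp (-r) (1 + r)`, and `exp (-r) ≥ 1 - r`. The quadratic order is what
makes a union over many thin annuli negligible. -/
lemma poissonMeasure_two_le (r : NNReal) :
    poissonMeasure r {n | 2 ≤ n} ≤ (r : ℝ≥0∞) ^ 2 := by
  have h1 : {n : ℕ | 2 ≤ n} = ({0, 1} : Set ℕ)ᶜ := by
    ext n
    simp only [Set.mem_ofPred_eq, Set.mem_compl_iff, Set.mem_insert_iff, Set.mem_singleton_iff]
    omega
  have h2 : (poissonMeasure r).real {n | 2 ≤ n} ≤ (r : ℝ) ^ 2 := by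
    rw [h1, probReal_compl_eq_one_sub (Set.to_countable _).measurableSet, Set.insert_eq,
      measureReal_union (by simp) (measurableSet_singleton _), poissonMeasure_real_singleton,
      poissonMeasure_real_singleton]
    have := Real.add_one_le_exp (-(r : ℝ))
    simp only [pow_zero, Nat.factorial, pow_one, Nat.cast_one, mul_one, div_one]
    nlinarith [r.coe_nonneg]
  rw [← ENNReal.ofReal_coe_nnreal, ← ENNReal.ofReal_pow r.coe_nonneg,
    ENNReal.le_ofReal_iff_toReal_le (measure_ne_top _ _) (by positivity)]
  exact h2

omit [IsProbabilityMeasure μ] in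
lemma measure_two_le_encard (hΦ : IsHomogeneousPPP (fun ω => Set.range fun n => X n ω) lam μ)
    (hlam : 0 ≤ lam) {B : Set ℂ} (hB : MeasurableSet B) (hv : volume B < ∞) :
    μ {ω | 2 ≤ ((Set.range fun n => X n ω) ∩ B).encard} ≤
      (ENNReal.ofReal lam * volume B) ^ 2 := by
  have h := hΦ.count_law B hB hv
  have h1 : μ {ω | 2 ≤ ((Set.range fun n => X n ω) ∩ B).encard} =
      (μ.map fun ω => ((Set.range fun n => X n ω) ∩ B).encard) {n | 2 ≤ n} := by
    rw [Measure.map_apply (hΦ.measurable_count B hB) .of_discrete]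
    rfl
  rw [h1, h, Measure.map_apply .of_discrete .of_discrete]
  have h2 : ((fun n : ℕ => (n : ℕ∞)) ⁻¹' {n | 2 ≤ n}) = {n | 2 ≤ n} := by
    ext n
    simp only [Set.mem_preimage, Set.mem_ofPred_eq]
    exact_mod_cast Iff.rfl
  rw [h2]
  refine (poissonMeasure_two_le _).trans_eq ?_
  congr 1
  change ENNReal.ofReal _ = _
  rw [ENNReal.ofReal_mul hlam, ENNReal.ofReal_toReal hv.ne]

lemma volume_annulus {h : ℝ} (hh : 0 ≤ h) (k : ℕ) :
    volume (Metric.ball (0 : ℂ) ((k + 1) * h) \ Metric.ball 0 (k * h)) =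
      ENNReal.ofReal (Real.pi * h ^ 2 * (2 * k + 1)) := by
  have hv : ∀ a : ℝ, 0 ≤ a → volume (Metric.ball (0 : ℂ) a) = ENNReal.ofReal (a ^ 2 * Real.pi) := by
    intro a ha
    rw [Complex.volume_ball, ENNReal.ofReal_mul (by positivity), ENNReal.ofReal_pow ha]
    congr 1
    rw [ENNReal.ofReal, Real.toNNReal_of_nonneg Real.pi_pos.le]
    rfl
  rw [measure_sdiff (Metric.ball_subset_ball (by nlinarith)) measurableSet_ball.nullMeasurableSet
    measure_ball_lt_top.ne, hv _ (by positivity), hv _ (by positivity),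
    ← ENNReal.ofReal_sub _ (by positivity)]
  congr 1
  ring

lemma two_le_encard_of_norm_eq {x : ℕ → ℂ} (hx : Function.Injective x) {n m : ℕ} (hnm : n ≠ m)
    {B : Set ℂ} (hn : x n ∈ B) (hm : x m ∈ B) : 2 ≤ (Set.range x ∩ B).encard := by
  rw [← Set.encard_pair (hx.ne hnm)]
  refine Set.encard_le_encard ?_
  rintro z (rfl | rfl)
  · exact ⟨⟨n, rfl⟩, hn⟩
  · exact ⟨⟨m, rfl⟩, hm⟩

omit [IsProbabilityMeasure μ] in
/-- Almost surely, the points of a Poisson process have distinct norms. -/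
lemma ae_norm_ne (hinj : ∀ᵐ ω ∂μ, Function.Injective fun n => X n ω)
    (hΦ : IsHomogeneousPPP (fun ω => Set.range fun n => X n ω) lam μ) (hlam : 0 ≤ lam) :
    ∀ᵐ ω ∂μ, ∀ n m, n ≠ m → ‖X n ω‖ ≠ ‖X m ω‖ := by
  suffices h : ∀ K : ℕ, ∀ᵐ ω ∂μ, ∀ n m, n ≠ m → ‖X n ω‖ < K → ‖X n ω‖ ≠ ‖X m ω‖ by
    rw [← ae_all_iff] at h
    filter_upwards [h] with ω hω n m hnm
    obtain ⟨K, hK⟩ := exists_nat_gt ‖X n ω‖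
    exact hω K n m hnm hK
  intro K
  let A : ℕ → ℕ → Set ℂ := fun N k =>
    Metric.ball (0 : ℂ) ((k + 1) * (K / (N + 1) : ℝ)) \ Metric.ball 0 (k * (K / (N + 1) : ℝ))
  have hA : ∀ N k, MeasurableSet (A N k) := fun N k => measurableSet_ball.diff measurableSet_ball
  -- With width `h = K / (N + 1)`, the area `π h² (2k + 1)` of an annulus is at most `2π K² / (N +
  -- 1)`, as `2k + 1 ≤ 2 (N + 1)`. Hence two points fall in a given annulus with probability at most
  -- `C / (N + 1)²`, and in some one of the `N + 1` annuli with probability at most `C / (N + 1)`.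
  let C : ℝ := (lam * (2 * Real.pi * K ^ 2)) ^ 2
  have hC : 0 ≤ C := by positivity
  have hbad : ∀ N : ℕ, μ (⋃ k ∈ Finset.range (N + 1),
      {ω | 2 ≤ ((Set.range fun n => X n ω) ∩ A N k).encard}) ≤
      ENNReal.ofReal (C / (N + 1)) := by
    intro N
    have hN : (0 : ℝ) < N + 1 := by positivity
    refine (measure_biUnion_finset_le _ _).trans ?_
    have hk : ∀ k ∈ Finset.range (N + 1),
        μ {ω | 2 ≤ ((Set.range fun n => X n ω) ∩ A N k).encard} ≤
          ENNReal.ofReal (C / (N + 1) ^ 2) := by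
      intro k hk
      have hkN : (k : ℝ) + 1 ≤ N + 1 := by exact_mod_cast Finset.mem_range.1 hk
      have hvol := volume_annulus (h := (K / (N + 1) : ℝ)) (by positivity) k
      refine (measure_two_le_encard hΦ hlam (hA N k) (hvol.trans_lt ENNReal.ofReal_lt_top)).trans ?_
      rw [hvol, ← ENNReal.ofReal_mul hlam, ← ENNReal.ofReal_pow (by positivity)]
      refine ENNReal.ofReal_le_ofReal ?_
      have hle : lam * (Real.pi * (K / (N + 1) : ℝ) ^ 2 * (2 * k + 1)) ≤
          lam * (2 * Real.pi * K ^ 2) / (N + 1) := by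
        rw [le_div_iff₀ hN]
        have : lam * (Real.pi * (K / (N + 1) : ℝ) ^ 2 * (2 * k + 1)) * (N + 1) =
            lam * (Real.pi * K ^ 2) * ((2 * k + 1) / (N + 1)) := by
          field_simp
        rw [this]
        have h2 : (2 * (k : ℝ) + 1) / (N + 1) ≤ 2 := by
          rw [div_le_iff₀ hN]
          linarith
        have h3 : 0 ≤ lam * (Real.pi * (K : ℝ) ^ 2) := by positivity
        nlinarith
      calc _ ≤ (lam * (2 * Real.pi * K ^ 2) / (N + 1)) ^ 2 :=
            pow_le_pow_left₀ (by positivity) hle 2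
        _ = C / (N + 1) ^ 2 := by rw [div_pow]
    refine (Finset.sum_le_sum hk).trans_eq ?_
    rw [Finset.sum_const, Finset.card_range, nsmul_eq_mul, ← ENNReal.ofReal_natCast,
      ← ENNReal.ofReal_mul (by positivity)]
    congr 1
    push_cast
    field_simp
  -- Two points of equal norm below `K` lie in a common annulus for every `N`, so they force
  -- membership in this null intersection.
  have hzero : μ (⋂ N : ℕ, ⋃ k ∈ Finset.range (N + 1),
      {ω | 2 ≤ ((Set.range fun n => X n ω) ∩ A N k).encard}) = 0 := by
    have hlim : Tendsto (fun N : ℕ => ENNReal.ofReal (C / (N + 1))) atTop (𝓝 0) := by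
      rw [← ENNReal.ofReal_zero]
      refine (ENNReal.continuous_ofReal.tendsto 0).comp ?_
      exact (tendsto_const_div_atTop_nhds_zero_nat C).comp (tendsto_add_atTop_nat 1) |>.congr
        fun n => by simp
    refine le_antisymm (ge_of_tendsto' hlim fun N => ?_) bot_le
    exact (measure_mono (Set.iInter_subset _ N)).trans (hbad N)
  have hae := measure_eq_zero_iff_ae_notMem.1 hzero
  filter_upwards [hae, hinj] with ω hω hi n m hnm hK heq
  refine hω (Set.mem_iInter.2 fun N => ?_)
  have hN : (0 : ℝ) < N + 1 := by positivity
  have hKpos : (0 : ℝ) < K := (norm_nonneg _).trans_lt hK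
  have hh : (0 : ℝ) < K / (N + 1) := by positivity
  have hmem : ∀ z : ℂ, ‖z‖ = ‖X n ω‖ → z ∈ A N ⌊‖X n ω‖ / (K / (N + 1) : ℝ)⌋₊ := by
    intro z hz
    have h1 := Nat.floor_le (div_nonneg (norm_nonneg (X n ω)) hh.le)
    have h2 := Nat.lt_floor_add_one (‖X n ω‖ / (K / (N + 1) : ℝ))
    rw [le_div_iff₀ hh] at h1
    rw [div_lt_iff₀ hh] at h2
    simp only [A, Set.mem_sdiff, Metric.mem_ball, dist_zero_right, hz, not_lt]
    exact ⟨h2, h1⟩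
  rw [Set.mem_iUnion₂]
  refine ⟨⌊‖X n ω‖ / (K / (N + 1) : ℝ)⌋₊, ?_, ?_⟩
  · rw [Finset.mem_range, Nat.floor_lt (by positivity), div_lt_iff₀ hh]
    push_cast
    rwa [mul_div_cancel₀ _ hN.ne']
  · exact two_le_encard_of_norm_eq hi hnm (hmem _ rfl) (hmem _ heq.symm)

/-- Each sector contains a point, balls contain finitely many, so a minimum is attained; distinct
norms make it unique. -/
theorem ae_regular (hX : ∀ n, Measurable (X n))
    (hinj : ∀ᵐ ω ∂μ, Function.Injective fun n => X n ω)
    (hΦ : IsHomogeneousPPP (fun ω => Set.range fun n => X n ω) lam μ) (hlam : 0 < lam) (M : ℕ) :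
    ∀ᵐ ω ∂μ, Regular M fun n => X n ω := by
  have h1 : ∀ᵐ ω ∂μ, ∀ i : Fin M, ∃ n, X n ω ∈ sector M i :=
    ae_all_iff.2 fun i => ae_exists_mem_sector hX hinj hΦ hlam i
  have h2 : ∀ᵐ ω ∂μ, ∀ K : ℕ,
      ((Set.range fun n => X n ω) ∩ Metric.closedBall 0 (K : ℝ)).encard ≠ ⊤ :=
    ae_all_iff.2 fun K => ae_encard_ne_top hΦ measurableSet_closedBall measure_closedBall_lt_top
  filter_upwards [h1, h2, hinj, ae_norm_ne hinj hΦ hlam.le] with ω hω1 hω2 hi hne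
  refine ⟨hi, fun i => ?_⟩
  obtain ⟨n₀, hn₀⟩ := hω1 i
  obtain ⟨K, hK⟩ := exists_nat_ge ‖X n₀ ω‖
  have hfin : {n | X n ω ∈ sector M i ∧ ‖X n ω‖ ≤ K}.Finite := by
    refine Set.Finite.of_finite_image ((Set.encard_ne_top_iff.1 (hω2 K)).subset ?_) hi.injOn
    rintro _ ⟨n, hn, rfl⟩
    exact ⟨⟨n, rfl⟩, by simpa using hn.2⟩
  obtain ⟨n, ⟨hn, hnK⟩, hmin⟩ := Set.exists_min_image _ (fun n => ‖X n ω‖) hfin ⟨n₀, hn₀, hK⟩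
  refine ⟨n, hn, fun m hm hmn => lt_of_le_of_ne ?_ (hne n m hmn.symm)⟩
  rcases le_total ‖X m ω‖ K with h | h
  · exact hmin m ⟨hm, h⟩
  · exact hnK.trans h

end Random

/-! ### Conditional law of the points beyond the nearest ones -/

section Kernel

variable {Ω : Type*} [MeasurableSpace Ω] {μ : Measure Ω} [IsProbabilityMeasure μ]
  {X : ℕ → Ω → ℂ} {lam : ℝ} {M : ℕ}

lemma measurable_sectorSum_uncurry {i : Fin M} {κ : ℝ → ℝ → ℝ≥0∞}
    (hκ : Measurable (Function.uncurry κ)) :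
    Measurable fun q : ℝ × (ℕ → ℂ) => sectorSum M i (κ q.1) q.2 := by
  refine Measurable.tsum fun n => ?_
  have hn : Measurable fun q : ℝ × (ℕ → ℂ) => q.2 n := (measurable_pi_apply n).comp measurable_snd
  exact (hκ.comp (measurable_fst.prodMk hn.norm)).indicator (hn (measurableSet_sector M i))

lemma measurable_expNeg_sectorSum {i : Fin M} {κ : ℝ → ℝ → ℝ≥0∞}
    (hκ : Measurable (Function.uncurry κ)) {ρ : Ω → ℝ} (hρ : Measurable ρ)
    (hX : ∀ n, Measurable (X n)) :
    Measurable fun ω => expNeg (sectorSum M i (κ (ρ ω)) fun n => X n ω) :=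
  measurable_expNeg.comp ((measurable_sectorSum_uncurry hκ).comp
    (hρ.prodMk (measurable_pi_lambda _ hX)))

lemma prod_expNeg_mem (g : Fin M → ℝ≥0∞) :
    0 ≤ ∏ i, expNeg (g i) ∧ ∏ i, expNeg (g i) ≤ 1 :=
  ⟨Finset.prod_nonneg fun _ _ => expNeg_nonneg _,
    Finset.prod_le_one (fun _ _ => expNeg_nonneg _) fun _ _ => expNeg_le_one _⟩

/-- Sums over disjoint annuli are independent. -/
lemma integral_prod_mul_prod_expNeg (hX : ∀ n, Measurable (X n))
    (hinj : ∀ᵐ ω ∂μ, Function.Injective fun n => X n ω)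
    (hΦ : IsHomogeneousPPP (fun ω => Set.range fun n => X n ω) lam μ) (hlam : 0 ≤ lam)
    {v w : Fin M → ℝ → ℝ≥0∞} (hv : ∀ i, Measurable (v i)) (hw : ∀ i, Measurable (w i))
    (h : ∀ i s, v i s = 0 ∨ w i s = 0) :
    ∫ ω, (∏ i, expNeg (sectorSum M i (v i) fun n => X n ω)) *
        ∏ i, expNeg (sectorSum M i (w i) fun n => X n ω) ∂μ =
      (∫ ω, ∏ i, expNeg (sectorSum M i (v i) fun n => X n ω) ∂μ) *
        ∏ i, ∫ ω, expNeg (sectorSum M i (w i) fun n => X n ω) ∂μ := by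
  -- At each distance `v` or `w` vanishes, so `1 - exp (-(v + w))` is the sum of the two separate
  -- terms: the exponents add and the Laplace functional factors.
  have h1 := integral_prod_expNeg_sectorSum hX hinj hΦ hlam (fun i s => v i s + w i s)
    fun i => (hv i).add (hw i)
  simp only [sectorSum_add, expNeg_add, Finset.prod_mul_distrib] at h1
  simp_rw [integral_expNeg_sectorSum hX hinj hΦ hlam _ (hw _)]
  rw [integral_prod_expNeg_sectorSum hX hinj hΦ hlam v hv, h1, ← Finset.prod_mul_distrib]
  refine Finset.prod_congr rfl fun i _ => ?_
  rw [← expNeg_add, ← mul_add, ← lintegral_add_left]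
  · congr 2
    refine setLIntegral_congr_fun measurableSet_Ioi fun s hs => ?_
    rcases h i s with h | h <;> simp [h]
  · exact ENNReal.measurable_ofReal.comp ((measurable_const.sub
      (measurable_expNeg.comp (hv i))).mul measurable_id)

lemma measurable_indicator_top (a : ℝ) :
    Measurable ((Set.Iio a).indicator fun _ => (∞ : ℝ≥0∞)) :=
  measurable_const.indicator measurableSet_Iio

/-- Given that the nearest points lie in prescribed annuli, the points beyond these annuli are
distributed as without conditioning. -/
lemma integral_prod_indicator_mul_prod_expNeg (hX : ∀ n, Measurable (X n))
    (hinj : ∀ᵐ ω ∂μ, Function.Injective fun n => X n ω)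
    (hΦ : IsHomogeneousPPP (fun ω => Set.range fun n => X n ω) lam μ) (hlam : 0 < lam)
    {a b : Fin M → ℝ} (hab : ∀ i, a i ≤ b i) {w : Fin M → ℝ → ℝ≥0∞} (hw : ∀ i, Measurable (w i))
    (hw0 : ∀ i s, s < b i → w i s = 0) :
    ∫ ω, (∏ i, (Set.Ico (a i) (b i)).indicator (fun _ => (1 : ℝ)) (minDist M i fun n => X n ω)) *
        ∏ i, expNeg (sectorSum M i (w i) fun n => X n ω) ∂μ =
      (∫ ω, ∏ i, (Set.Ico (a i) (b i)).indicator (fun _ => (1 : ℝ))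
        (minDist M i fun n => X n ω) ∂μ) *
        ∏ i, ∫ ω, expNeg (sectorSum M i (w i) fun n => X n ω) ∂μ := by
  -- The indicator of `[a, b)` is `1{· ≥ a} - 1{· ≥ b}`, and each of these is a void event, that is,
  -- the `expNeg` of an infinite weight on the points closer than `a` or `b`. The product over
  -- sectors expands into a signed sum over the choices `β` of an end point.
  let c : Fin M → Bool → ℝ := fun i β => if β then a i else b i
  let e : Fin M → Bool → (ℕ → ℂ) → ℝ := fun i β x =>
    expNeg (sectorSum M i ((Set.Iio (c i β)).indicator fun _ => ∞) x)
  let σ : Bool → ℝ := fun β => if β then 1 else -1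
  have hexp : ∀ᵐ ω ∂μ, ∏ i, (Set.Ico (a i) (b i)).indicator (fun _ => (1 : ℝ))
      (minDist M i fun n => X n ω) =
      ∑ β : Fin M → Bool, (∏ i, σ (β i)) * ∏ i, e i (β i) fun n => X n ω := by
    filter_upwards [ae_regular hX hinj hΦ hlam M] with ω hω
    simp_rw [← Finset.prod_mul_distrib]
    rw [← Fintype.piFinset_univ,
      ← Finset.prod_univ_sum (fun _ => Finset.univ) fun i β => σ β * e i β fun n => X n ω]
    refine Finset.prod_congr rfl fun i _ => ?_
    simp only [Fintype.sum_bool, σ, e, c, if_true, Bool.false_eq_true, if_false,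
      hω.expNeg_sectorSum_top, one_mul, neg_one_mul]
    set t := minDist M i fun n => X n ω
    have := hab i
    by_cases h1 : a i ≤ t
    · by_cases h2 : b i ≤ t
      · simp [Set.indicator, h1, h2]
      · simp [Set.indicator, h1, h2, not_le.1 h2]
    · have h2 : ¬ b i ≤ t := fun h => h1 (this.trans h)
      simp [Set.indicator, h1, h2]
  have hXm : Measurable fun ω (n : ℕ) => X n ω := measurable_pi_lambda _ hX
  have hem : ∀ i β, Measurable fun ω => e i β fun n => X n ω := fun i β =>
    measurable_expNeg.comp ((measurable_sectorSum (measurable_indicator_top _)).comp hXm)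
  have hwm : Measurable fun ω => ∏ i, expNeg (sectorSum M i (w i) fun n => X n ω) :=
    Finset.measurable_fun_prod _ fun i _ =>
      measurable_expNeg.comp ((measurable_sectorSum (hw i)).comp hXm)
  have hprodm : ∀ β : Fin M → Bool, Measurable fun ω => ∏ i, e i (β i) fun n => X n ω :=
    fun β => Finset.measurable_fun_prod _ fun i _ => hem i (β i)
  have hterm : ∀ β : Fin M → Bool,
      ∫ ω, (∏ i, e i (β i) fun n => X n ω) *
        ∏ i, expNeg (sectorSum M i (w i) fun n => X n ω) ∂μ =
      (∫ ω, ∏ i, e i (β i) fun n => X n ω ∂μ) *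
        ∏ i, ∫ ω, expNeg (sectorSum M i (w i) fun n => X n ω) ∂μ := fun β =>
    integral_prod_mul_prod_expNeg hX hinj hΦ hlam.le
      -- The void weight lives below `c ≤ b` and `w` lives at or above `b`, so their supports are
      -- disjoint.
      (fun i => measurable_indicator_top _) hw fun i s => by
        rcases lt_or_ge s (c i (β i)) with h | h
        · refine Or.inr (hw0 i s (h.trans_le ?_))
          simp only [c]
          split_ifs
          exacts [hab i, le_rfl]
        · exact Or.inl (Set.indicator_of_notMem (by simpa using h) _)
  have hint : ∀ β : Fin M → Bool, Integrable (fun ω => ∏ i, e i (β i) fun n => X n ω) μ :=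
    fun β => integrable_of_unit_bounds (hprodm β) (fun ω => (prod_expNeg_mem _).1)
      fun ω => (prod_expNeg_mem _).2
  have hint2 : ∀ β : Fin M → Bool, Integrable (fun ω => (∏ i, e i (β i) fun n => X n ω) *
      ∏ i, expNeg (sectorSum M i (w i) fun n => X n ω)) μ :=
    fun β => integrable_of_unit_bounds ((hprodm β).mul hwm)
      (fun ω => mul_nonneg (prod_expNeg_mem _).1 (prod_expNeg_mem _).1)
      fun ω => mul_le_one₀ (prod_expNeg_mem _).2 (prod_expNeg_mem _).1 (prod_expNeg_mem _).2
  have hL : ∫ ω, (∏ i, (Set.Ico (a i) (b i)).indicator (fun _ => (1 : ℝ))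
      (minDist M i fun n => X n ω)) * ∏ i, expNeg (sectorSum M i (w i) fun n => X n ω) ∂μ =
      ∑ β : Fin M → Bool, (∏ i, σ (β i)) * ∫ ω, (∏ i, e i (β i) fun n => X n ω) *
        ∏ i, expNeg (sectorSum M i (w i) fun n => X n ω) ∂μ := by
    simp_rw [← integral_const_mul]
    rw [← integral_finsetSum _ fun β _ => (hint2 β).const_mul _]
    refine integral_congr_ae ?_
    filter_upwards [hexp] with ω hω
    rw [hω, Finset.sum_mul]
    exact Finset.sum_congr rfl fun β _ => mul_assoc _ _ _
  have hR : ∫ ω, ∏ i, (Set.Ico (a i) (b i)).indicator (fun _ => (1 : ℝ))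
      (minDist M i fun n => X n ω) ∂μ =
      ∑ β : Fin M → Bool, (∏ i, σ (β i)) * ∫ ω, ∏ i, e i (β i) fun n => X n ω ∂μ := by
    simp_rw [← integral_const_mul]
    rw [← integral_finsetSum _ fun β _ => (hint β).const_mul _]
    exact integral_congr_ae hexp
  rw [hL, hR, Finset.sum_mul]
  refine Finset.sum_congr rfl fun β _ => ?_
  rw [hterm, mul_assoc]

/-- The right end point of the cell of `t` in the partition of `[a, ∞)` into intervals of
length `1 / (m + 1)`. -/
def gridUp (a : ℝ) (m : ℕ) (t : ℝ) : ℝ := a + (⌊(t - a) * (m + 1)⌋₊ + 1) / (m + 1)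

lemma measurable_gridUp (a : ℝ) (m : ℕ) : Measurable (gridUp a m) := by
  have : Measurable fun t : ℝ => ⌊(t - a) * (m + 1)⌋₊ := Nat.measurable_floor.comp (by fun_prop)
  have h2 : Measurable fun n : ℕ => a + ((n : ℝ) + 1) / (m + 1) := Measurable.of_discrete
  exact h2.comp this

lemma lt_gridUp {a t : ℝ} (m : ℕ) : t < gridUp a m t := by
  have hm : (0 : ℝ) < m + 1 := by positivity
  have h := Nat.lt_floor_add_one ((t - a) * (m + 1))
  have : t - a < (⌊(t - a) * (m + 1)⌋₊ + 1) / (m + 1) := by rwa [lt_div_iff₀ hm]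
  rw [gridUp]
  linarith

lemma gridUp_le {a t : ℝ} (h : a ≤ t) (m : ℕ) : gridUp a m t ≤ t + 1 / (m + 1) := by
  have hm : (0 : ℝ) < m + 1 := by positivity
  have h := Nat.floor_le (mul_nonneg (sub_nonneg.2 h) hm.le)
  have : (⌊(t - a) * (m + 1)⌋₊ : ℝ) / (m + 1) ≤ t - a := by rwa [div_le_iff₀ hm]
  rw [gridUp, add_div]
  linarith

lemma tendsto_gridUp {a t : ℝ} (h : a ≤ t) :
    Tendsto (fun m => gridUp a m t) atTop (𝓝 t) := by
  refine tendsto_of_tendsto_of_tendsto_of_le_of_le tendsto_const_nhds ?_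
    (fun m => (lt_gridUp m).le) fun m => gridUp_le h m
  simpa using (tendsto_one_div_add_atTop_nhds_zero_nat (𝕜 := ℝ)).const_add t

lemma floor_eq_iff_mem_Ico {a t : ℝ} (h : a ≤ t) (m k : ℕ) :
    ⌊(t - a) * (m + 1)⌋₊ = k ↔
      t ∈ Set.Ico (a + k / (m + 1) : ℝ) (a + (k + 1) / (m + 1)) := by
  have hm : (0 : ℝ) < m + 1 := by positivity
  rw [Nat.floor_eq_iff (mul_nonneg (sub_nonneg.2 h) hm.le), ← div_le_iff₀ hm, ← lt_div_iff₀ hm,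
    Set.mem_Ico]
  constructor <;> rintro ⟨h1, h2⟩ <;> constructor <;> linarith

/-- The orthant is the countable disjoint union of the grid cells, so equality on every cell
suffices. -/
lemma setIntegral_eq_of_grid {α : Type*} [MeasurableSpace α] {ν : Measure α} {R : Fin M → α → ℝ}
    (hR : ∀ i, Measurable (R i)) (a : Fin M → ℝ) (m : ℕ) {g h : α → ℝ} (hg : Integrable g ν)
    (hh : Integrable h ν)
    (H : ∀ k : Fin M → ℕ, ∫ ω in {ω | ∀ i, R i ω ∈ Set.Ico (a i + k i / (m + 1) : ℝ)
        (a i + (k i + 1) / (m + 1))}, g ω ∂ν =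
      ∫ ω in {ω | ∀ i, R i ω ∈ Set.Ico (a i + k i / (m + 1) : ℝ)
        (a i + (k i + 1) / (m + 1))}, h ω ∂ν) :
    ∫ ω in {ω | ∀ i, a i ≤ R i ω}, g ω ∂ν = ∫ ω in {ω | ∀ i, a i ≤ R i ω}, h ω ∂ν := by
  have hm : (0 : ℝ) < m + 1 := by positivity
  have hle : ∀ (i : Fin M) (k : ℕ) (ω : α), R i ω ∈ Set.Ico (a i + k / (m + 1) : ℝ)
      (a i + (k + 1) / (m + 1)) → a i ≤ R i ω := by
    intro i k ω hω
    have : (0 : ℝ) ≤ k / (m + 1) := by positivity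
    linarith [hω.1]
  have hU : {ω | ∀ i, a i ≤ R i ω} = ⋃ k : Fin M → ℕ,
      {ω | ∀ i, R i ω ∈ Set.Ico (a i + k i / (m + 1) : ℝ) (a i + (k i + 1) / (m + 1))} := by
    ext ω
    simp only [Set.mem_ofPred_eq, Set.mem_iUnion]
    constructor
    · intro h
      exact ⟨fun i => ⌊(R i ω - a i) * (m + 1)⌋₊, fun i => (floor_eq_iff_mem_Ico (h i) m _).1 rfl⟩
    · rintro ⟨k, hk⟩ i
      exact hle i _ ω (hk i)
  have hmeas : ∀ k : Fin M → ℕ, MeasurableSet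
      {ω | ∀ i, R i ω ∈ Set.Ico (a i + k i / (m + 1) : ℝ) (a i + (k i + 1) / (m + 1))} := by
    intro k
    have : {ω | ∀ i, R i ω ∈ Set.Ico (a i + k i / (m + 1) : ℝ) (a i + (k i + 1) / (m + 1))} =
        ⋂ i, R i ⁻¹' Set.Ico (a i + k i / (m + 1) : ℝ) (a i + (k i + 1) / (m + 1)) := by
      ext ω
      simp
    rw [this]
    exact MeasurableSet.iInter fun i => hR i measurableSet_Ico
  have hdis : Pairwise (Function.onFun Disjoint fun k : Fin M → ℕ =>
      {ω | ∀ i, R i ω ∈ Set.Ico (a i + k i / (m + 1) : ℝ) (a i + (k i + 1) / (m + 1))}) := by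
    intro k l hkl
    rw [Function.onFun, Set.disjoint_left]
    intro ω hk hl
    refine hkl (funext fun i => ?_)
    have h0 := hle i _ ω (hk i)
    rw [← (floor_eq_iff_mem_Ico h0 m _).2 (hk i), (floor_eq_iff_mem_Ico h0 m _).2 (hl i)]
  rw [hU, integral_iUnion hmeas hdis hg.integrableOn, integral_iUnion hmeas hdis hh.integrableOn]
  exact tsum_congr H

lemma setIntegral_eq_integral_prod_indicator {α : Type*} [MeasurableSpace α] {ν : Measure α}
    {R : Fin M → α → ℝ} (hR : ∀ i, Measurable (R i)) {B : Fin M → Set ℝ}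
    (hB : ∀ i, MeasurableSet (B i)) (g : α → ℝ) :
    ∫ ω in {ω | ∀ i, R i ω ∈ B i}, g ω ∂ν =
      ∫ ω, (∏ i, (B i).indicator (fun _ => (1 : ℝ)) (R i ω)) * g ω ∂ν := by
  have hm : MeasurableSet {ω | ∀ i, R i ω ∈ B i} := by
    have : {ω | ∀ i, R i ω ∈ B i} = ⋂ i, R i ⁻¹' B i := by
      ext ω
      simp
    rw [this]
    exact MeasurableSet.iInter fun i => hR i (hB i)
  rw [← integral_indicator hm]
  refine integral_congr_ae (.of_forall fun ω => ?_)
  by_cases h : ∀ i, R i ω ∈ B i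
  · simp [Set.indicator, h]
  · have h' : ω ∉ {ω | ∀ i, R i ω ∈ B i} := h
    simp only [Set.indicator_of_notMem h']
    push Not at h
    obtain ⟨i, hi⟩ := h
    rw [Finset.prod_eq_zero (Finset.mem_univ i) (Set.indicator_of_notMem hi _), zero_mul]

variable {κ κ' : Fin M → ℝ → ℝ → ℝ≥0∞}

/-- The conditional law of the configuration given the nearest distances, tested on functions of
the points beyond the nearest ones and on orthants. -/
lemma setIntegral_prod_expNeg_of_le (hX : ∀ n, Measurable (X n))
    (hinj : ∀ᵐ ω ∂μ, Function.Injective fun n => X n ω)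
    (hΦ : IsHomogeneousPPP (fun ω => Set.range fun n => X n ω) lam μ) (hlam : 0 < lam)
    (hκ : ∀ i, Measurable (Function.uncurry (κ i)))
    (hκ0 : ∀ i b s, s < b → κ i b s = 0)
    (hlim : ∀ i (x : ℕ → ℂ) (r : ℝ) (b : ℕ → ℝ), 0 < r → (∀ m, r < b m) →
      Tendsto b atTop (𝓝 r) →
      Tendsto (fun m => sectorSum M i (κ i (b m)) x) atTop (𝓝 (sectorSum M i (κ' i r) x)))
    (a : Fin M → ℝ) :
    ∫ ω in {ω | ∀ i, a i ≤ minDist M i fun n => X n ω},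
        ∏ i, expNeg (sectorSum M i (κ' i (minDist M i fun n => X n ω)) fun n => X n ω) ∂μ =
      ∫ ω in {ω | ∀ i, a i ≤ minDist M i fun n => X n ω},
        ∏ i, ∫ η, expNeg (sectorSum M i (κ' i (minDist M i fun n => X n ω)) fun n => X n η) ∂μ
          ∂μ := by
  have hXm : Measurable fun ω (n : ℕ) => X n ω := measurable_pi_lambda _ hX
  have hR : ∀ i : Fin M, Measurable fun ω => minDist M i fun n => X n ω := fun i =>
    (measurable_minDist M i).comp hXm
  have hgr : ∀ (i : Fin M) m, Measurable fun ω => gridUp (a i) m (minDist M i fun n => X n ω) :=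
    fun i m => (measurable_gridUp (a i) m).comp (hR i)
  have hH : ∀ i, Measurable fun b => ∫ η, expNeg (sectorSum M i (κ i b) fun n => X n η) ∂μ := by
    intro i
    have h1 : Measurable fun q : ℝ × Ω => expNeg (sectorSum M i (κ i q.1) fun n => X n q.2) :=
      measurable_expNeg.comp ((measurable_sectorSum_uncurry (hκ i)).comp
        (measurable_fst.prodMk (hXm.comp measurable_snd)))
    exact h1.stronglyMeasurable.integral_prod_right.measurable
  have hH01 : ∀ (v : ℝ → ℝ≥0∞) (i : Fin M),
      0 ≤ ∫ η, expNeg (sectorSum M i v fun n => X n η) ∂μ ∧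
      ∫ η, expNeg (sectorSum M i v fun n => X n η) ∂μ ≤ 1 := by
    intro v i
    refine ⟨integral_nonneg fun _ => expNeg_nonneg _, ?_⟩
    refine (integral_mono_of_nonneg (.of_forall fun _ => expNeg_nonneg _) (integrable_const 1)
      (.of_forall fun _ => expNeg_le_one _)).trans_eq (by simp)
  -- On a cell the grid point is a constant `b`, and the kernel at `b` only sees points at distance
  -- at least `b`, beyond every nearest distance allowed in the cell. The decoupling over annuli
  -- therefore applies.
  have hcell : ∀ m : ℕ, ∫ ω in {ω | ∀ i, a i ≤ minDist M i fun n => X n ω},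
        ∏ i, expNeg (sectorSum M i (κ i (gridUp (a i) m (minDist M i fun n => X n ω)))
          fun n => X n ω) ∂μ =
      ∫ ω in {ω | ∀ i, a i ≤ minDist M i fun n => X n ω},
        ∏ i, ∫ η, expNeg (sectorSum M i (κ i (gridUp (a i) m (minDist M i fun n => X n ω)))
          fun n => X n η) ∂μ ∂μ := by
    intro m
    refine setIntegral_eq_of_grid (R := fun i ω => minDist M i fun n => X n ω) hR a m ?_ ?_ ?_
    · exact integrable_of_unit_bounds (Finset.measurable_fun_prod _ fun i _ =>
        measurable_expNeg_sectorSum (hκ i) (hgr i m) hX) (fun ω => (prod_expNeg_mem _).1)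
        fun ω => (prod_expNeg_mem _).2
    · exact integrable_of_unit_bounds (Finset.measurable_fun_prod _ fun i _ =>
        (hH i).comp (hgr i m)) (fun ω => Finset.prod_nonneg fun i _ => (hH01 _ i).1)
        fun ω => Finset.prod_le_one (fun i _ => (hH01 _ i).1) fun i _ => (hH01 _ i).2
    · intro k
      let b : Fin M → ℝ := fun i => a i + (k i + 1) / (m + 1)
      have hm : (0 : ℝ) < m + 1 := by positivity
      have hb : ∀ (i : Fin M) ω, (minDist M i fun n => X n ω) ∈
          Set.Ico (a i + k i / (m + 1) : ℝ) (a i + (k i + 1) / (m + 1)) →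
          gridUp (a i) m (minDist M i fun n => X n ω) = b i := by
        intro i ω hω
        have h0 : a i ≤ minDist M i fun n => X n ω := by
          have : (0 : ℝ) ≤ k i / (m + 1) := by positivity
          linarith [hω.1]
        rw [gridUp, (floor_eq_iff_mem_Ico h0 m _).2 hω]
      have hmeas : MeasurableSet {ω | ∀ i : Fin M, (minDist M i fun n => X n ω) ∈
          Set.Ico (a i + k i / (m + 1) : ℝ) (a i + (k i + 1) / (m + 1))} := by
        have : {ω | ∀ i : Fin M, (minDist M i fun n => X n ω) ∈
            Set.Ico (a i + k i / (m + 1) : ℝ) (a i + (k i + 1) / (m + 1))} =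
            ⋂ i : Fin M, (fun ω => minDist M i fun n => X n ω) ⁻¹'
              Set.Ico (a i + k i / (m + 1) : ℝ) (a i + (k i + 1) / (m + 1)) := by
          ext ω
          simp
        rw [this]
        exact MeasurableSet.iInter fun i => hR i measurableSet_Ico
      have hl : ∀ ω ∈ {ω | ∀ i : Fin M, (minDist M i fun n => X n ω) ∈
          Set.Ico (a i + k i / (m + 1) : ℝ) (a i + (k i + 1) / (m + 1))},
          ∏ i, expNeg (sectorSum M i (κ i (gridUp (a i) m (minDist M i fun n => X n ω)))
            fun n => X n ω) = ∏ i, expNeg (sectorSum M i (κ i (b i)) fun n => X n ω) := by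
        intro ω hω
        exact Finset.prod_congr rfl fun i _ => by rw [hb i ω (hω i)]
      have hr : ∀ ω ∈ {ω | ∀ i : Fin M, (minDist M i fun n => X n ω) ∈
          Set.Ico (a i + k i / (m + 1) : ℝ) (a i + (k i + 1) / (m + 1))},
          ∏ i, ∫ η, expNeg (sectorSum M i (κ i (gridUp (a i) m (minDist M i fun n => X n ω)))
            fun n => X n η) ∂μ = ∏ i, ∫ η, expNeg (sectorSum M i (κ i (b i)) fun n => X n η) ∂μ := by
        intro ω hω
        exact Finset.prod_congr rfl fun i _ => by rw [hb i ω (hω i)]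
      rw [setIntegral_congr_fun hmeas hl, setIntegral_congr_fun hmeas hr,
        setIntegral_eq_integral_prod_indicator (R := fun i ω => minDist M i fun n => X n ω)
          hR (fun i => measurableSet_Ico),
        setIntegral_eq_integral_prod_indicator (R := fun i ω => minDist M i fun n => X n ω)
          hR (fun i => measurableSet_Ico), integral_mul_const]
      refine integral_prod_indicator_mul_prod_expNeg hX hinj hΦ hlam (fun i => ?_)
        (fun i => (hκ i).comp (measurable_const.prodMk measurable_id)) fun i s hs => hκ0 i _ s hs
      have : (k i : ℝ) / (m + 1) ≤ (k i + 1) / (m + 1) := by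
        rw [div_le_div_iff_of_pos_right hm]
        linarith
      linarith
  have hreg := ae_regular hX hinj hΦ hlam M
  have hae : ∀ᵐ ω ∂μ.restrict {ω | ∀ i, a i ≤ minDist M i fun n => X n ω},
      (∀ i, a i ≤ minDist M i fun n => X n ω) ∧ Regular M fun n => X n ω := by
    have hmeas : MeasurableSet {ω | ∀ i, a i ≤ minDist M i fun n => X n ω} := by
      have : {ω | ∀ i, a i ≤ minDist M i fun n => X n ω} =
          ⋂ i, (fun ω => minDist M i fun n => X n ω) ⁻¹' Set.Ici (a i) := by
        ext ω
        simp
      rw [this]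
      exact MeasurableSet.iInter fun i => hR i measurableSet_Ici
    exact (ae_restrict_mem hmeas).and (ae_restrict_of_ae hreg)
  -- The mesh now tends to zero: the grid points approach the nearest distances strictly from above,
  -- and all integrands stay in `[0, 1]`.
  have hT1 : Tendsto (fun m => ∫ ω in {ω | ∀ i, a i ≤ minDist M i fun n => X n ω},
        ∏ i, expNeg (sectorSum M i (κ i (gridUp (a i) m (minDist M i fun n => X n ω)))
          fun n => X n ω) ∂μ) atTop
      (𝓝 (∫ ω in {ω | ∀ i, a i ≤ minDist M i fun n => X n ω},
        ∏ i, expNeg (sectorSum M i (κ' i (minDist M i fun n => X n ω)) fun n => X n ω) ∂μ)) := by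
    refine tendsto_integral_of_dominated_convergence (fun _ => 1) (fun m => ?_)
      (integrable_const _) (fun m => .of_forall fun ω => ?_) ?_
    · exact (Finset.measurable_fun_prod _ fun i _ =>
        measurable_expNeg_sectorSum (hκ i) (hgr i m) hX).aestronglyMeasurable
    · rw [Real.norm_of_nonneg (prod_expNeg_mem _).1]
      exact (prod_expNeg_mem _).2
    · filter_upwards [hae] with ω hω
      exact tendsto_finsetProd _ fun i _ => (continuous_expNeg.tendsto _).comp
        (hlim i _ _ _ (hω.2.minDist_pos i) (fun m => lt_gridUp m) (tendsto_gridUp (hω.1 i)))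
  have hT2 : Tendsto (fun m => ∫ ω in {ω | ∀ i, a i ≤ minDist M i fun n => X n ω},
        ∏ i, ∫ η, expNeg (sectorSum M i (κ i (gridUp (a i) m (minDist M i fun n => X n ω)))
          fun n => X n η) ∂μ ∂μ) atTop
      (𝓝 (∫ ω in {ω | ∀ i, a i ≤ minDist M i fun n => X n ω},
        ∏ i, ∫ η, expNeg (sectorSum M i (κ' i (minDist M i fun n => X n ω)) fun n => X n η) ∂μ
          ∂μ)) := by
    refine tendsto_integral_of_dominated_convergence (fun _ => 1) (fun m => ?_)
      (integrable_const _) (fun m => .of_forall fun ω => ?_) ?_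
    · exact (Finset.measurable_fun_prod _ fun i _ =>
        (hH i).comp (hgr i m)).aestronglyMeasurable
    · rw [Real.norm_of_nonneg (Finset.prod_nonneg fun i _ => (hH01 _ i).1)]
      exact Finset.prod_le_one (fun i _ => (hH01 _ i).1) fun i _ => (hH01 _ i).2
    · filter_upwards [hae] with ω hω
      refine tendsto_finsetProd _ fun i _ => ?_
      refine tendsto_integral_of_dominated_convergence (fun _ => 1) (fun m => ?_)
        (integrable_const _) (fun m => .of_forall fun η => ?_) (.of_forall fun η => ?_)
      · exact (measurable_expNeg_sectorSum (hκ i) measurable_const hX).aestronglyMeasurable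
      · rw [Real.norm_of_nonneg (expNeg_nonneg _)]
        exact expNeg_le_one _
      · exact (continuous_expNeg.tendsto _).comp
          (hlim i _ _ _ (hω.2.minDist_pos i) (fun m => lt_gridUp m) (tendsto_gridUp (hω.1 i)))
  exact tendsto_nhds_unique hT1 (by simpa only [hcell] using hT2)

end Kernel

/-! ### From orthants to arbitrary weights of the distances -/

section Kernel

variable {Ω : Type*} [MeasurableSpace Ω] {μ : Measure Ω} [IsProbabilityMeasure μ]
  {X : ℕ → Ω → ℂ} {lam : ℝ} {M : ℕ}

/-- Two bounded weights have the same conditional expectation given `R` as soon as their integrals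
agree over the events that `R` lies in an orthant. -/
lemma integral_mul_eq_of_setIntegral_Ici {R : Ω → Fin M → ℝ} (hR : Measurable R)
    (hR0 : ∀ ω, 0 ≤ R ω) {g h : Ω → ℝ} (hg : Measurable g) (hh : Measurable h)
    (hg0 : ∀ ω, 0 ≤ g ω) (hg1 : ∀ ω, g ω ≤ 1) (hh0 : ∀ ω, 0 ≤ h ω) (hh1 : ∀ ω, h ω ≤ 1)
    (H : ∀ a : Fin M → ℝ, ∫ ω in {ω | ∀ i, a i ≤ R ω i}, g ω ∂μ =
      ∫ ω in {ω | ∀ i, a i ≤ R ω i}, h ω ∂μ)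
    {φ : (Fin M → ℝ) → ℝ} (hφ : Measurable φ) :
    ∫ ω, φ (R ω) * g ω ∂μ = ∫ ω, φ (R ω) * h ω ∂μ := by
  have hgi := integrable_of_unit_bounds (μ := μ) hg hg0 hg1
  have hhi := integrable_of_unit_bounds (μ := μ) hh hh0 hh1
  -- The claim compares the laws of `R` weighted by `g` and by `h`. These are finite measures, and
  -- orthants form a π-system generating the Borel sets.
  have hfin : ∀ g : Ω → ℝ, Integrable g μ →
      IsFiniteMeasure ((μ.withDensity fun ω => ENNReal.ofReal (g ω)).map R) := by
    intro g hg
    have := isFiniteMeasure_withDensity_ofReal hg.2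
    infer_instance
  have hev : ∀ g : Ω → ℝ, Integrable g μ → (∀ ω, 0 ≤ g ω) → ∀ a : Fin M → ℝ,
      (μ.withDensity fun ω => ENNReal.ofReal (g ω)).map R (Set.Ici a) =
        ENNReal.ofReal (∫ ω in {ω | ∀ i, a i ≤ R ω i}, g ω ∂μ) := by
    intro g hg hg0 a
    rw [Measure.map_apply hR measurableSet_Ici, withDensity_apply _ (hR measurableSet_Ici),
      ofReal_integral_eq_lintegral_ofReal hg.integrableOn (.of_forall hg0)]
    rfl
  -- Since `R` is nonnegative, the total mass is the mass of the orthant at the origin, so it is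
  -- covered by `H`.
  have huniv : ∀ g : Ω → ℝ, (μ.withDensity fun ω => ENNReal.ofReal (g ω)).map R Set.univ =
      (μ.withDensity fun ω => ENNReal.ofReal (g ω)).map R (Set.Ici 0) := by
    intro g
    rw [Measure.map_apply hR .univ, Measure.map_apply hR measurableSet_Ici]
    congr 1
    ext ω
    simpa using hR0 ω
  have hint : ∀ g : Ω → ℝ, Measurable g → (∀ ω, 0 ≤ g ω) →
      ∫ r, φ r ∂((μ.withDensity fun ω => ENNReal.ofReal (g ω)).map R) =
        ∫ ω, φ (R ω) * g ω ∂μ := by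
    intro g hg hg0
    rw [integral_map hR.aemeasurable hφ.aestronglyMeasurable,
      integral_withDensity_eq_integral_toReal_smul hg.ennreal_ofReal
        (.of_forall fun _ => ENNReal.ofReal_lt_top)]
    refine integral_congr_ae (.of_forall fun ω => ?_)
    simp only [ENNReal.toReal_ofReal (hg0 ω), smul_eq_mul, mul_comm]
  have hspan : IsCountablySpanning (Set.range (Set.Ici : ℝ → Set ℝ)) := by
    refine ⟨fun n : ℕ => Set.Ici (-(n : ℝ)), fun n => ⟨_, rfl⟩, ?_⟩
    refine Set.eq_univ_of_forall fun t => ?_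
    obtain ⟨n, hn⟩ := exists_nat_ge (-t)
    exact Set.mem_iUnion.2 ⟨n, by rw [Set.mem_Ici]; linarith⟩
  have hgen : (inferInstance : MeasurableSpace (Fin M → ℝ)) = MeasurableSpace.generateFrom
      (Set.pi Set.univ '' Set.pi Set.univ fun _ => Set.range (Set.Ici : ℝ → Set ℝ)) := by
    rw [← generateFrom_pi_eq fun _ => hspan, ← borel_eq_generateFrom_Ici, ← BorelSpace.measurable_eq]
  have hmeas : (μ.withDensity fun ω => ENNReal.ofReal (g ω)).map R =
      (μ.withDensity fun ω => ENNReal.ofReal (h ω)).map R := by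
    have := hfin g hgi
    refine ext_of_generate_finite _ hgen (IsPiSystem.pi fun _ => isPiSystem_Ici) ?_ ?_
    · rintro _ ⟨s, hs, rfl⟩
      choose a ha using fun i => hs i (Set.mem_univ i)
      have : Set.pi Set.univ s = Set.Ici a := by
        rw [← Set.pi_univ_Ici]
        congr 1
        exact funext fun i => (ha i).symm
      rw [this, hev g hgi hg0, hev h hhi hh0, H]
    · rw [huniv, huniv, hev g hgi hg0, hev h hhi hh0, H]
  rw [← hint g hg hg0, ← hint h hh hh0, hmeas]

end Kernel

/-! ### Path loss and logarithmic gain -/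

namespace Params

variable {p : Params}

lemma Admissible.pathLoss_pos (hp : p.Admissible) {r : ℝ} (hr : 0 < r) : 0 < p.pathLoss r := by
  rw [pathLoss]
  split_ifs
  · exact mul_pos hp.CL_pos (Real.rpow_pos_of_pos hr _)
  · exact mul_pos hp.CN_pos (Real.rpow_pos_of_pos hr _)

lemma measurable_pathLoss (p : Params) : Measurable p.pathLoss := by
  refine Measurable.ite measurableSet_Iio ?_ ?_ <;> fun_prop

/-- The path loss may jump at `Rc` but is continuous from the right there, which is why the grid
approaches from above. -/
lemma tendsto_pathLoss {r : ℝ} (hr : 0 < r) {b : ℕ → ℝ} (hb : ∀ m, r < b m)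
    (hlim : Tendsto b atTop (𝓝 r)) : Tendsto (fun m => p.pathLoss (b m)) atTop
      (𝓝 (p.pathLoss r)) := by
  have hpow : ∀ a c : ℝ, Tendsto (fun m => c * b m ^ a) atTop (𝓝 (c * r ^ a)) := fun a c =>
    ((Real.continuousAt_rpow_const r a (Or.inl hr.ne')).tendsto.comp hlim).const_mul c
  by_cases h : r < p.Rc
  · rw [pathLoss, if_pos h]
    refine (hpow p.aL p.CL).congr' ?_
    filter_upwards [hlim.eventually (gt_mem_nhds h)] with m hm
    rw [pathLoss, if_pos hm]
  · rw [pathLoss, if_neg h]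
    refine (hpow p.aN p.CN).congr fun m => ?_
    rw [pathLoss, if_neg (not_lt.2 ((not_lt.1 h).trans (hb m).le))]

/-- The logarithm of `1 + Γ l(b) / l(s)`. -/
def logGain (p : Params) (b s : ℝ) : ℝ≥0∞ :=
  ENNReal.ofReal (Real.log (1 + p.Gam * p.pathLoss b / p.pathLoss s))

lemma measurable_logGain (p : Params) : Measurable (Function.uncurry p.logGain) := by
  have h := p.measurable_pathLoss
  unfold logGain Function.uncurry
  fun_prop

lemma Admissible.gain_nonneg (hp : p.Admissible) {b s : ℝ} (hb : 0 < b) (hs : 0 < s) :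
    0 ≤ p.Gam * p.pathLoss b / p.pathLoss s :=
  div_nonneg (mul_nonneg hp.Gam_pos.le (hp.pathLoss_pos hb).le) (hp.pathLoss_pos hs).le

/-- The logarithm writes the factor contributed by an interferer as an `expNeg`, so that products
over points become Laplace functionals. -/
lemma Admissible.expNeg_logGain (hp : p.Admissible) {b s : ℝ} (hb : 0 < b) (hs : 0 < s) (k : ℕ) :
    expNeg (k * p.logGain b s) = 1 / (1 + p.Gam * p.pathLoss b / p.pathLoss s) ^ k := by
  have h := hp.gain_nonneg hb hs
  rw [expNeg_nsmul, logGain, expNeg_ofReal (Real.log_nonneg (by linarith)), Real.exp_neg,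
    Real.exp_log (by linarith), inv_pow, one_div]

lemma Admissible.logGain_mono (hp : p.Admissible) {r b s : ℝ} (hr : 0 < r) (hrb : r ≤ b)
    (hs : 0 < s) : p.logGain r s ≤ p.logGain b s := by
  have h := hp.gain_nonneg hr hs
  refine ENNReal.ofReal_le_ofReal (Real.log_le_log (by linarith) ?_)
  have h2 : p.pathLoss r ≤ p.pathLoss b := hp.monotone_pathLoss hr.le (hr.le.trans hrb) hrb
  have h3 := hp.pathLoss_pos hs
  have h4 := hp.Gam_pos
  gcongr

/-- Concavity of the logarithm. -/
lemma Admissible.logGain_le (hp : p.Admissible) {r b s : ℝ} (hr : 0 < r) (hrb : r ≤ b)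
    (hs : 0 < s) :
    p.logGain b s ≤ ENNReal.ofReal (p.pathLoss b / p.pathLoss r) * p.logGain r s := by
  have h := hp.gain_nonneg hr hs
  have hr' := hp.pathLoss_pos hr
  have h2 : p.pathLoss r ≤ p.pathLoss b := hp.monotone_pathLoss hr.le (hr.le.trans hrb) hrb
  have hC : 1 ≤ p.pathLoss b / p.pathLoss r := (one_le_div hr').2 h2
  rw [logGain, logGain, ← ENNReal.ofReal_mul (by linarith)]
  refine ENNReal.ofReal_le_ofReal ?_
  rw [← Real.log_rpow (by linarith)]
  refine Real.log_le_log (by linarith [hp.gain_nonneg (hr.trans_le hrb) hs]) ?_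
  -- Bernoulli's inequality `1 + C x ≤ (1 + x) ^ C` with `C = l(b) / l(r) ≥ 1` and `x = Γ l(r) /
  -- l(s)`.
  refine le_trans (le_of_eq ?_) (one_add_mul_self_le_rpow_one_add (by linarith) hC)
  field_simp

end Params

/-! ### The detection probability and its moments -/

section Load

variable {p : Params} {M : ℕ}

/-- Every term is eventually constant: a point beyond `r` is eventually beyond `b m`, and no other
point is ever counted. Fatou's lemma for the counting measure gives the lower bound and inclusion
the upper one, so an infinite sum is allowed. -/
lemma tendsto_sectorSum_indicator (i : Fin M) (v : ℝ → ℝ≥0∞) (x : ℕ → ℂ) {r : ℝ} {b : ℕ → ℝ}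
    (hb : ∀ m, r < b m) (hlim : Tendsto b atTop (𝓝 r)) :
    Tendsto (fun m => sectorSum M i ((Set.Ici (b m)).indicator v) x) atTop
      (𝓝 (sectorSum M i ((Set.Ioi r).indicator v) x)) := by
  have hterm : ∀ n, Tendsto (fun m => (sector M i).indicator
      (fun z => (Set.Ici (b m)).indicator v ‖z‖) (x n)) atTop
      (𝓝 ((sector M i).indicator (fun z => (Set.Ioi r).indicator v ‖z‖) (x n))) := by
    intro n
    refine tendsto_const_nhds.congr' ?_
    by_cases hn : x n ∈ sector M i
    · simp only [Set.indicator_of_mem hn]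
      by_cases h : r < ‖x n‖
      · filter_upwards [hlim.eventually (gt_mem_nhds h)] with m hm
        rw [Set.indicator_of_mem (Set.mem_Ioi.2 h), Set.indicator_of_mem (Set.mem_Ici.2 hm.le)]
      · refine .of_forall fun m => ?_
        change (Set.Ioi r).indicator v ‖x n‖ = (Set.Ici (b m)).indicator v ‖x n‖
        rw [Set.indicator_of_notMem (by simpa using h), Set.indicator_of_notMem]
        rw [Set.mem_Ici, not_le]
        exact (not_lt.1 h).trans_lt (hb m)
    · simp [Set.indicator_of_notMem hn]
  have hle : ∀ m, sectorSum M i ((Set.Ici (b m)).indicator v) x ≤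
      sectorSum M i ((Set.Ioi r).indicator v) x := by
    intro m
    refine ENNReal.tsum_le_tsum fun n => Set.indicator_le_indicator ?_
    exact Set.indicator_le_indicator_of_subset
      (fun s hs => (hb m).trans_le hs) (fun _ => bot_le) _
  have h := lintegral_liminf_le (μ := Measure.count) (ι := ℕ) (u := atTop)
    (f := fun m n => (sector M i).indicator (fun z => (Set.Ici (b m)).indicator v ‖z‖) (x n))
    fun m => Measurable.of_discrete
  simp only [lintegral_count, (hterm _).liminf_eq] at h
  exact tendsto_of_le_liminf_of_limsup_le h (limsup_le_of_le (h := .of_forall hle))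

/-- The sum is squeezed between the one with gain frozen at `r` and its multiple by `l(b m) / l(r)`,
which tends to `1`. No finiteness of the interference sum is needed. -/
lemma tendsto_sectorSum_logGain (hp : p.Admissible) (i : Fin M) (x : ℕ → ℂ) {r : ℝ}
    {b : ℕ → ℝ} (hr : 0 < r) (hb : ∀ m, r < b m) (hlim : Tendsto b atTop (𝓝 r)) :
    Tendsto (fun m => sectorSum M i ((Set.Ici (b m)).indicator (p.logGain (b m))) x) atTop
      (𝓝 (sectorSum M i ((Set.Ioi r).indicator (p.logGain r)) x)) := by
  have h1 := tendsto_sectorSum_indicator i (p.logGain r) x hb hlim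
  have hC : Tendsto (fun m => ENNReal.ofReal (p.pathLoss (b m) / p.pathLoss r)) atTop (𝓝 1) := by
    rw [← ENNReal.ofReal_one, ← div_self (hp.pathLoss_pos hr).ne']
    exact (ENNReal.continuous_ofReal.tendsto _).comp
      ((Params.tendsto_pathLoss hr hb hlim).div_const _)
  have h2 := ENNReal.Tendsto.mul hC (Or.inl one_ne_zero) h1 (Or.inr ENNReal.one_ne_top)
  rw [one_mul] at h2
  refine tendsto_of_tendsto_of_tendsto_of_le_of_le h1 h2 (fun m => ?_) fun m => ?_
  · refine ENNReal.tsum_le_tsum fun n => ?_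
    by_cases hn : x n ∈ sector M i
    · simp only [Set.indicator_of_mem hn]
      exact Set.indicator_le_indicator (hp.logGain_mono hr (hb m).le (norm_pos_iff.2 hn.1))
    · simp [Set.indicator_of_notMem hn]
  · simp only [sectorSum]
    rw [← ENNReal.tsum_mul_left]
    refine ENNReal.tsum_le_tsum fun n => ?_
    by_cases hn : x n ∈ sector M i
    · simp only [Set.indicator_of_mem hn]
      by_cases h : ‖x n‖ ∈ Set.Ici (b m)
      · simp only [Set.indicator_of_mem h]
        exact hp.logGain_le hr (hb m).le (norm_pos_iff.2 hn.1)
      · simp [Set.indicator_of_notMem h]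
    · simp [Set.indicator_of_notMem hn]

lemma sectorSum_const_mul (i : Fin M) (c : ℝ≥0∞) (s : Set ℝ) (v : ℝ → ℝ≥0∞) (x : ℕ → ℂ) :
    sectorSum M i (s.indicator fun t => c * v t) x = c * sectorSum M i (s.indicator v) x := by
  rw [sectorSum, sectorSum, ← ENNReal.tsum_mul_left]
  refine tsum_congr fun n => ?_
  by_cases hn : x n ∈ sector M i
  · simp only [Set.indicator_of_mem hn]
    by_cases h : ‖x n‖ ∈ s
    · simp only [Set.indicator_of_mem h]
    · simp [Set.indicator_of_notMem h]
  · simp [Set.indicator_of_notMem hn]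

/-- The conditional probability, given the configuration `x`, that the nearest point of the `i`-th
sector is detected in a given cycle. -/
def detProb (p : Params) (M : ℕ) (i : Fin M) (x : ℕ → ℂ) : ℝ :=
  Real.exp (-(p.W * p.Gam * p.pathLoss (minDist M i x) / (p.P * M))) *
    expNeg (sectorSum M i ((Set.Ioi (minDist M i x)).indicator (p.logGain (minDist M i x))) x)

/-- The mean of the `k`-th power of the detection probability when the nearest point is at
distance `r`. -/
def detMoment (p : Params) (M k : ℕ) (r : ℝ) : ℝ :=
  Real.exp (-(p.W * k * p.Gam * p.pathLoss r / (p.P * M))) *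
    expNeg (ENNReal.ofReal (2 * p.lam * Real.pi / M) * p.interfIntegral k r)

lemma f_eq_sum_detMoment (p : Params) (M j : ℕ) (r : ℝ) :
    p.f M j r = ∑ k ∈ Finset.range (j + 1), (-1 : ℝ) ^ k * (j.choose k : ℝ) *
      detMoment p M k r := by
  simp only [Params.f, detMoment, expNeg, mul_assoc]

lemma detMoment_nonneg (p : Params) (M k : ℕ) (r : ℝ) : 0 ≤ detMoment p M k r :=
  mul_nonneg (Real.exp_nonneg _) (expNeg_nonneg _)

lemma detMoment_le_one (hp : p.Admissible) (k : ℕ) {r : ℝ} (hr : 0 < r) :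
    detMoment p M k r ≤ 1 := by
  refine mul_le_one₀ ?_ (expNeg_nonneg _) (expNeg_le_one _)
  have h1 := hp.pathLoss_pos hr
  have h2 := hp.W_nonneg
  have h3 := hp.Gam_pos
  have h4 := hp.P_pos
  refine Real.exp_le_one_iff.2 (neg_nonpos.2 ?_)
  positivity

/-- A crude bound by the sum of the binomial coefficients, enough for integrability. -/
lemma abs_f_le (hp : p.Admissible) (j : ℕ) {r : ℝ} (hr : 0 < r) : |p.f M j r| ≤ 2 ^ j := by
  have h : ((2 : ℝ) ^ j) = ∑ k ∈ Finset.range (j + 1), (j.choose k : ℝ) := by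
    exact_mod_cast (Nat.sum_range_choose j).symm
  rw [f_eq_sum_detMoment, h]
  refine (Finset.abs_sum_le_sum_abs _ _).trans (Finset.sum_le_sum fun k _ => ?_)
  rw [abs_mul, abs_mul, abs_pow, abs_neg, abs_one, one_pow, one_mul, Nat.abs_cast,
    abs_of_nonneg (detMoment_nonneg p M k r)]
  exact mul_le_of_le_one_right (Nat.cast_nonneg _) (detMoment_le_one hp k hr)

lemma measurable_interfIntegral (p : Params) (k : ℕ) : Measurable (p.interfIntegral k) := by
  have h := p.measurable_pathLoss
  have hF : Measurable fun q : ℝ × ℝ => (if q.1 < q.2 then ENNReal.ofReal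
      ((1 - 1 / (1 + p.Gam * p.pathLoss q.1 / p.pathLoss q.2) ^ k) * q.2) else 0 : ℝ≥0∞) :=
    Measurable.ite (measurableSet_lt measurable_fst measurable_snd) (by fun_prop) measurable_const
  have heq : p.interfIntegral k = fun r => ∫⁻ s, (if r < s then ENNReal.ofReal
      ((1 - 1 / (1 + p.Gam * p.pathLoss r / p.pathLoss s) ^ k) * s) else 0 : ℝ≥0∞) := by
    funext r
    rw [Params.interfIntegral, ← lintegral_indicator measurableSet_Ioi]
    rfl
  rw [heq]
  exact hF.lintegral_prod_right'

lemma measurable_detMoment (p : Params) (M k : ℕ) : Measurable (detMoment p M k) := by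
  have h := p.measurable_pathLoss
  refine Measurable.mul (by fun_prop) (measurable_expNeg.comp
    ((measurable_interfIntegral p k).const_mul _))

lemma measurable_f (p : Params) (M j : ℕ) : Measurable (p.f M j) := by
  rw [funext (f_eq_sum_detMoment p M j)]
  exact Finset.measurable_fun_sum _ fun k _ => (measurable_detMoment p M k).const_mul _

lemma f_zero (p : Params) (M : ℕ) (r : ℝ) : p.f M 0 r = 1 := by
  simp [f_eq_sum_detMoment, detMoment, Params.interfIntegral]

lemma measurable_logGain_indicator (p : Params) (k : ℝ≥0∞) :
    Measurable (Function.uncurry fun b => (Set.Ioi b).indicator fun s => k * p.logGain b s) :=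
  ((p.measurable_logGain).const_mul k).indicator (measurableSet_lt measurable_fst measurable_snd)

lemma measurable_logGain_indicator_Ici (p : Params) (k : ℝ≥0∞) :
    Measurable (Function.uncurry fun b => (Set.Ici b).indicator fun s => k * p.logGain b s) :=
  ((p.measurable_logGain).const_mul k).indicator (measurableSet_le measurable_fst measurable_snd)

lemma measurable_detProb (p : Params) (M : ℕ) (i : Fin M) : Measurable (detProb p M i) := by
  have h := p.measurable_pathLoss
  have hR := measurable_minDist M i
  refine Measurable.mul (by fun_prop) ?_
  have h1 := measurable_expNeg_sectorSum (Ω := ℕ → ℂ) (X := fun n x => x n) (i := i)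
    (measurable_logGain_indicator p 1) hR fun n => measurable_pi_apply n
  simpa only [one_mul] using h1

lemma detProb_nonneg (p : Params) (M : ℕ) (i : Fin M) (x : ℕ → ℂ) : 0 ≤ detProb p M i x :=
  mul_nonneg (Real.exp_nonneg _) (expNeg_nonneg _)

lemma detProb_le_one (hp : p.Admissible) (i : Fin M) {x : ℕ → ℂ} (hx : Regular M x) :
    detProb p M i x ≤ 1 := by
  refine mul_le_one₀ ?_ (expNeg_nonneg _) (expNeg_le_one _)
  have h1 := hp.pathLoss_pos (hx.minDist_pos i)
  have h2 := hp.W_nonneg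
  have h3 := hp.Gam_pos
  have h4 := hp.P_pos
  refine Real.exp_le_one_iff.2 (neg_nonpos.2 ?_)
  positivity

lemma detProb_pow (p : Params) (M : ℕ) (i : Fin M) (x : ℕ → ℂ) (k : ℕ) :
    detProb p M i x ^ k =
      Real.exp (-(p.W * k * p.Gam * p.pathLoss (minDist M i x) / (p.P * M))) *
      expNeg (sectorSum M i ((Set.Ioi (minDist M i x)).indicator
        fun s => k * p.logGain (minDist M i x) s) x) := by
  rw [detProb, mul_pow, ← Real.exp_nat_mul, sectorSum_const_mul, expNeg_nsmul]
  congr 2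
  ring

end Load

/-! ### Conditional moments of the detection probabilities -/

section Network

variable {Ω : Type*} [MeasurableSpace Ω] {μ : Measure Ω} [IsProbabilityMeasure μ]
  {p : Params} {X : ℕ → Ω → ℂ} {M : ℕ}

lemma integral_expNeg_logGain (hp : p.Admissible) (hX : ∀ n, Measurable (X n))
    (hinj : ∀ᵐ ω ∂μ, Function.Injective fun n => X n ω)
    (hΦ : IsHomogeneousPPP (fun ω => Set.range fun n => X n ω) p.lam μ) (i : Fin M) (k : ℕ)
    {r : ℝ} (hr : 0 < r) :
    ∫ ω, expNeg (sectorSum M i ((Set.Ioi r).indicator fun s => k * p.logGain r s)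
      fun n => X n ω) ∂μ =
      expNeg (ENNReal.ofReal (2 * p.lam * Real.pi / M) * p.interfIntegral k r) := by
  rw [integral_expNeg_sectorSum (v := (Set.Ioi r).indicator fun s => k * p.logGain r s)
    hX hinj hΦ hp.lam_pos.le i ((measurable_logGain_indicator p k).comp (measurable_const.prodMk measurable_id))]
  congr 2
  rw [Params.interfIntegral, ← lintegral_indicator measurableSet_Ioi,
    ← lintegral_indicator measurableSet_Ioi]
  refine lintegral_congr fun s => ?_
  by_cases hs : r < s
  · have hs0 : 0 < s := hr.trans hs
    simp only [Set.indicator_of_mem (Set.mem_Ioi.2 hs), Set.indicator_of_mem (Set.mem_Ioi.2 hs0),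
      hp.expNeg_logGain hr hs0]
  · have hs' : s ∉ Set.Ioi r := by simpa using hs
    rw [Set.indicator_of_notMem hs', Set.indicator_apply]
    simp only [Set.indicator_of_notMem hs', expNeg_zero, sub_self, zero_mul, ENNReal.ofReal_zero,
      ite_self]

/-- A power of `detProb` is a function of the distance times the `expNeg` of a sum over the points
strictly beyond it. Given the distances, that sum may be evaluated on an unconditioned copy of the
process, whose Laplace functional is the exponential in `detMoment`. -/
theorem integral_prod_detProb_pow (hp : p.Admissible) (hX : ∀ n, Measurable (X n))
    (hinj : ∀ᵐ ω ∂μ, Function.Injective fun n => X n ω)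
    (hΦ : IsHomogeneousPPP (fun ω => Set.range fun n => X n ω) p.lam μ) (k : Fin M → ℕ)
    {φ : (Fin M → ℝ) → ℝ} (hφ : Measurable φ) :
    ∫ ω, φ (nearestDist X M ω) * ∏ i, detProb p M i (fun n => X n ω) ^ k i ∂μ =
      ∫ ω, φ (nearestDist X M ω) * ∏ i, detMoment p M (k i) (nearestDist X M ω i) ∂μ := by
  have hXm : Measurable fun ω (n : ℕ) => X n ω := measurable_pi_lambda _ hX
  have hRi : ∀ i : Fin M, Measurable fun ω => minDist M i fun n => X n ω := fun i =>
    (measurable_minDist M i).comp hXm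
  have hR : Measurable (nearestDist X M) := measurable_pi_lambda _ hRi
  let κ' : Fin M → ℝ → ℝ → ℝ≥0∞ := fun i b =>
    (Set.Ioi b).indicator fun s => k i * p.logGain b s
  let κ : Fin M → ℝ → ℝ → ℝ≥0∞ := fun i b =>
    (Set.Ici b).indicator fun s => k i * p.logGain b s
  have hκ' : ∀ i, Measurable (Function.uncurry (κ' i)) := fun i =>
    measurable_logGain_indicator p (k i)
  -- The noise factors depend on the distances only and are absorbed into the weight.
  let ψ : (Fin M → ℝ) → ℝ := fun r =>
    φ r * ∏ i, Real.exp (-(p.W * k i * p.Gam * p.pathLoss (r i) / (p.P * M)))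
  have hψ : Measurable ψ := by
    have h := p.measurable_pathLoss
    refine hφ.mul (Finset.measurable_fun_prod _ fun i _ => ?_)
    have h2 : Measurable fun r : Fin M → ℝ => p.pathLoss (r i) := h.comp (measurable_pi_apply i)
    fun_prop
  have hHm : ∀ i, Measurable fun b => ∫ η, expNeg (sectorSum M i (κ' i b) fun n => X n η) ∂μ := by
    intro i
    have h1 : Measurable fun q : ℝ × Ω => expNeg (sectorSum M i (κ' i q.1) fun n => X n q.2) :=
      measurable_expNeg.comp ((measurable_sectorSum_uncurry (hκ' i)).comp
        (measurable_fst.prodMk (hXm.comp measurable_snd)))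
    exact h1.stronglyMeasurable.integral_prod_right.measurable
  have hH01 : ∀ (v : ℝ → ℝ≥0∞) (i : Fin M),
      0 ≤ ∫ η, expNeg (sectorSum M i v fun n => X n η) ∂μ ∧
      ∫ η, expNeg (sectorSum M i v fun n => X n η) ∂μ ≤ 1 := by
    intro v i
    refine ⟨integral_nonneg fun _ => expNeg_nonneg _, ?_⟩
    refine (integral_mono_of_nonneg (.of_forall fun _ => expNeg_nonneg _) (integrable_const 1)
      (.of_forall fun _ => expNeg_le_one _)).trans_eq (by simp)
  have hmain := integral_mul_eq_of_setIntegral_Ici (μ := μ) hR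
    (fun ω i => minDist_nonneg M i _)
    (g := fun ω => ∏ i, expNeg (sectorSum M i (κ' i (minDist M i fun n => X n ω))
      fun n => X n ω))
    (h := fun ω => ∏ i, ∫ η, expNeg (sectorSum M i (κ' i (minDist M i fun n => X n ω))
      fun n => X n η) ∂μ)
    (Finset.measurable_fun_prod _ fun i _ => measurable_expNeg_sectorSum (hκ' i) (hRi i) hX)
    (Finset.measurable_fun_prod _ fun i _ => (hHm i).comp (hRi i))
    (fun ω => (prod_expNeg_mem _).1) (fun ω => (prod_expNeg_mem _).2)
    (fun ω => Finset.prod_nonneg fun i _ => (hH01 _ i).1)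
    (fun ω => Finset.prod_le_one (fun i _ => (hH01 _ i).1) fun i _ => (hH01 _ i).2)
    (setIntegral_prod_expNeg_of_le (κ := κ) hX hinj hΦ hp.lam_pos
      (fun i => measurable_logGain_indicator_Ici p (k i))
      (fun i b s hs => Set.indicator_of_notMem (by simpa using hs) _)
      (fun i x r b hr hb hlim => by
        simp only [κ, κ', sectorSum_const_mul]
        exact ENNReal.Tendsto.const_mul (tendsto_sectorSum_logGain hp i x hr hb hlim)
          (Or.inr (ENNReal.natCast_ne_top _))))
    hψ
  have hl : ∫ ω, φ (nearestDist X M ω) * ∏ i, detProb p M i (fun n => X n ω) ^ k i ∂μ =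
      ∫ ω, ψ (nearestDist X M ω) * ∏ i, expNeg (sectorSum M i
        (κ' i (minDist M i fun n => X n ω)) fun n => X n ω) ∂μ := by
    refine integral_congr_ae (.of_forall fun ω => ?_)
    simp only [ψ, mul_assoc, ← Finset.prod_mul_distrib, detProb_pow, nearestDist_eq, κ']
  rw [hl, hmain]
  refine integral_congr_ae ?_
  filter_upwards [ae_regular hX hinj hΦ hp.lam_pos M] with ω hω
  simp only [ψ, mul_assoc, ← Finset.prod_mul_distrib, nearestDist_eq, κ']
  congr 1
  refine Finset.prod_congr rfl fun i _ => ?_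
  rw [integral_expNeg_logGain hp hX hinj hΦ i (k i) (hω.minDist_pos i), detMoment]
  congr 3
  ring

lemma one_sub_pow_eq_sum (q : ℝ) (j : ℕ) : (1 - q) ^ j =
    ∑ k ∈ Finset.range (j + 1), (-1 : ℝ) ^ k * (j.choose k : ℝ) * q ^ k := by
  rw [sub_eq_neg_add, add_pow]
  refine Finset.sum_congr rfl fun k _ => ?_
  rw [one_pow, mul_one, neg_pow]
  ring

/-- Both products expand by the binomial theorem into the same combination of mixed moments, which
are then compared term by term. -/
theorem setIntegral_prod_one_sub_detProb_pow (hp : p.Admissible) (hX : ∀ n, Measurable (X n))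
    (hinj : ∀ᵐ ω ∂μ, Function.Injective fun n => X n ω)
    (hΦ : IsHomogeneousPPP (fun ω => Set.range fun n => X n ω) p.lam μ) (j : Fin M → ℕ)
    {A : Set (Fin M → ℝ)} (hA : MeasurableSet A) :
    ∫ ω in nearestDist X M ⁻¹' A, ∏ i, (1 - detProb p M i fun n => X n ω) ^ j i ∂μ =
      ∫ ω in nearestDist X M ⁻¹' A, ∏ i, p.f M (j i) (nearestDist X M ω i) ∂μ := by
  have hXm : Measurable fun ω (n : ℕ) => X n ω := measurable_pi_lambda _ hX
  have hR : Measurable (nearestDist X M) :=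
    measurable_pi_lambda _ fun i => (measurable_minDist M i).comp hXm
  let φ : (Fin M → ℝ) → ℝ := A.indicator fun _ => 1
  have hφ : Measurable φ := measurable_const.indicator hA
  have hset : ∀ g : Ω → ℝ, ∫ ω in nearestDist X M ⁻¹' A, g ω ∂μ =
      ∫ ω, φ (nearestDist X M ω) * g ω ∂μ := by
    intro g
    rw [← integral_indicator (hR hA)]
    refine integral_congr_ae (.of_forall fun ω => ?_)
    by_cases h : nearestDist X M ω ∈ A
    · simp only [φ, Set.indicator_of_mem h, one_mul, Set.indicator_of_mem
        (show ω ∈ nearestDist X M ⁻¹' A from h)]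
    · simp only [φ, Set.indicator_of_notMem h, zero_mul, Set.indicator_of_notMem
        (show ω ∉ nearestDist X M ⁻¹' A from h)]
  have hφ1 : ∀ r, ‖φ r‖ ≤ 1 := by
    intro r
    simp only [φ]
    by_cases h : r ∈ A <;> simp [h]
  rw [hset, hset]
  simp only [one_sub_pow_eq_sum, f_eq_sum_detMoment, Finset.prod_univ_sum, Finset.mul_sum,
    Finset.prod_mul_distrib]
  simp only [mul_left_comm (φ _)]
  have hm : ∀ k : Fin M → ℕ, Measurable fun ω => φ (nearestDist X M ω) *
      ∏ i, detProb p M i (fun n => X n ω) ^ k i := fun k =>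
    (hφ.comp hR).mul (Finset.measurable_fun_prod _ fun i _ =>
      ((measurable_detProb p M i).comp hXm).pow_const _)
  have hm' : ∀ k : Fin M → ℕ, Measurable fun ω => φ (nearestDist X M ω) *
      ∏ i, detMoment p M (k i) (nearestDist X M ω i) := fun k =>
    (hφ.comp hR).mul (Finset.measurable_fun_prod _ fun i _ =>
      (measurable_detMoment p M (k i)).comp ((measurable_pi_apply i).comp hR))
  have hreg := ae_regular hX hinj hΦ hp.lam_pos M
  rw [integral_finsetSum, integral_finsetSum]
  · refine Finset.sum_congr rfl fun k _ => ?_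
    rw [integral_const_mul, integral_const_mul, integral_prod_detProb_pow hp hX hinj hΦ k hφ]
  · intro k _
    refine Integrable.const_mul (Integrable.of_bound (hm' k).aestronglyMeasurable 1 ?_) _
    filter_upwards [hreg] with ω hω
    rw [norm_mul]
    refine mul_le_one₀ (hφ1 _) (norm_nonneg _) ?_
    rw [Real.norm_of_nonneg (Finset.prod_nonneg fun i _ => detMoment_nonneg p M (k i) _)]
    exact Finset.prod_le_one (fun i _ => detMoment_nonneg p M (k i) _) fun i _ =>
      detMoment_le_one hp (k i) (hω.minDist_pos i)
  · intro k _
    refine Integrable.const_mul (Integrable.of_bound (hm k).aestronglyMeasurable 1 ?_) _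
    filter_upwards [hreg] with ω hω
    rw [norm_mul]
    refine mul_le_one₀ (hφ1 _) (norm_nonneg _) ?_
    have h0 : ∀ i, 0 ≤ detProb p M i (fun n => X n ω) ^ k i := fun i =>
      pow_nonneg (detProb_nonneg p M i _) _
    rw [Real.norm_of_nonneg (Finset.prod_nonneg fun i _ => h0 i)]
    exact Finset.prod_le_one (fun i _ => h0 i) fun i _ =>
      pow_le_one₀ (detProb_nonneg p M i _) (detProb_le_one hp i hω)

end Network

/-! ### Measurability of the detection events -/

section Measurability

variable {Ω : Type*} {mΩ : MeasurableSpace Ω} {p : Params} {X : ℕ → Ω → ℂ}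
  {F : ℕ → ℕ → Ω → ℝ} {M : ℕ}

open Classical in
lemma interference_eq (i : Fin M) (t n : ℕ) (ω : Ω) :
    interference p X F M i t n ω = ∑' m, if m ≠ n then
      (if X m ω ∈ sector M i then rxPower p X F t m ω else 0) else 0 := by
  refine tsum_congr fun m => ?_
  by_cases h1 : m = n <;> by_cases h2 : X m ω ∈ sector M i <;> simp [h1, h2]

open Classical in
-- Only the powers received from points of the sector are assumed measurable, so the result also
-- applies to the σ-algebra generated by the fading of a single sector in a single cycle.
lemma measurableSet_sectorDetected_of_rxPower (hX : ∀ n, Measurable (X n)) (i : Fin M) (t : ℕ)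
    (h : ∀ m, Measurable fun ω => if X m ω ∈ sector M i then rxPower p X F t m ω else 0) :
    MeasurableSet {ω | SectorDetected p X F M i t ω} := by
  have hS : ∀ n, MeasurableSet {ω | X n ω ∈ sector M i} := fun n => hX n (measurableSet_sector M i)
  have hnear : ∀ n, MeasurableSet {ω | IsNearest X M i n ω} := by
    intro n
    have : {ω | IsNearest X M i n ω} = {ω | X n ω ∈ sector M i} ∩
        ⋂ m, ({ω | X m ω ∈ sector M i}ᶜ ∪ {ω | ‖X n ω‖ ≤ ‖X m ω‖}) := by
      ext ω
      simp only [IsNearest, Set.mem_ofPred_eq, Set.mem_inter_iff, Set.mem_iInter, Set.mem_union,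
        Set.mem_compl_iff, imp_iff_not_or]
    rw [this]
    exact (hS n).inter (MeasurableSet.iInter fun m => (hS m).compl.union
      (measurableSet_le (hX n).norm (hX m).norm))
  have hsinr : ∀ n, Measurable fun ω =>
      (if X n ω ∈ sector M i then rxPower p X F t n ω else 0) /
        ((∑' m, if m ≠ n then (if X m ω ∈ sector M i then rxPower p X F t m ω else 0) else 0) +
          ENNReal.ofReal (p.W / (p.P * M))) := by
    intro n
    refine (h n).div (Measurable.add_const (Measurable.tsum fun m => ?_) _)
    by_cases hm : m ≠ n
    · simpa only [if_pos hm] using h m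
    · simp only [if_neg hm, measurable_const]
  have : {ω | SectorDetected p X F M i t ω} = ⋃ n, {ω | IsNearest X M i n ω} ∩
      {ω | ENNReal.ofReal p.Gam < (if X n ω ∈ sector M i then rxPower p X F t n ω else 0) /
        ((∑' m, if m ≠ n then (if X m ω ∈ sector M i then rxPower p X F t m ω else 0) else 0) +
          ENNReal.ofReal (p.W / (p.P * M)))} := by
    ext ω
    simp only [SectorDetected, Set.mem_ofPred_eq, Set.mem_iUnion, Set.mem_inter_iff, sinr,
      interference_eq]
    refine exists_congr fun n => and_congr_right fun hn => ?_
    rw [if_pos hn.1]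
  rw [this]
  exact MeasurableSet.iUnion fun n => (hnear n).inter
    (measurableSet_lt measurable_const (hsinr n))

lemma measurableSet_sectorDetected (hX : ∀ n, Measurable (X n))
    (hF : ∀ t n, Measurable (F t n)) (i : Fin M) (t : ℕ) :
    MeasurableSet {ω | SectorDetected p X F M i t ω} := by
  classical
  refine measurableSet_sectorDetected_of_rxPower hX i t fun m => ?_
  refine Measurable.ite (hX m (measurableSet_sector M i)) ?_ measurable_const
  exact ENNReal.measurable_ofReal.comp ((hF t m).div (p.measurable_pathLoss.comp (hX m).norm))

lemma measurableSet_undetected (hX : ∀ n, Measurable (X n))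
    (hF : ∀ t n, Measurable (F t n)) (i : Fin M) (j : ℕ) :
    MeasurableSet (undetected p X F M i j) := by
  have : undetected p X F M i j =
      ⋂ (t : ℕ) (_ : 1 ≤ t) (_ : t ≤ j), {ω | SectorDetected p X F M i t ω}ᶜ := by
    ext ω
    simp [undetected]
  rw [this]
  exact MeasurableSet.iInter fun t => MeasurableSet.iInter fun _ => MeasurableSet.iInter fun _ =>
    (measurableSet_sectorDetected hX hF i t).compl

end Measurability

/-! ### Exponential variables -/

section Exponential

lemma expMeasure_Ioi {c : ℝ} (hc : 0 ≤ c) :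
    expMeasure 1 (Set.Ioi c) = ENNReal.ofReal (Real.exp (-c)) := by
  have := isProbabilityMeasure_expMeasure one_pos
  rw [← Set.compl_Iic, prob_compl_eq_one_sub measurableSet_Iic, ← ofReal_cdf,
    cdf_expMeasure_eq one_pos, if_pos hc, ← ENNReal.ofReal_one, ← ENNReal.ofReal_sub]
  · congr 1
    ring_nf
  · simpa using hc

lemma expMeasure_lt_ofReal (y : ℝ≥0∞) :
    expMeasure 1 {z | y < ENNReal.ofReal z} = ENNReal.ofReal (expNeg y) := by
  by_cases hy : y = ∞
  · simp [hy]
  · have h : {z | y < ENNReal.ofReal z} = Set.Ioi y.toReal := by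
      ext z
      exact ENNReal.lt_ofReal_iff_toReal_lt hy
    rw [h, expMeasure_Ioi ENNReal.toReal_nonneg, ← expNeg_ofReal ENNReal.toReal_nonneg,
      ENNReal.ofReal_toReal hy]

/-- The weight `exp (-c z)` tilts the density of rate `1` into `1 / (1 + c)` times the density of
rate `1 + c`. -/
lemma integral_expNeg_expMeasure {c : ℝ} (hc : 0 ≤ c) :
    ∫ z, expNeg (ENNReal.ofReal (c * z)) ∂(expMeasure 1) = 1 / (1 + c) := by
  have h1 : ∫⁻ z, ENNReal.ofReal (expNeg (ENNReal.ofReal (c * z))) ∂(expMeasure 1) =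
      ENNReal.ofReal (1 / (1 + c)) := by
    have hm : Measurable fun z : ℝ => ENNReal.ofReal (expNeg (ENNReal.ofReal (c * z))) :=
      ENNReal.measurable_ofReal.comp (measurable_expNeg.comp (by fun_prop))
    have hd : expMeasure 1 = volume.withDensity (exponentialPDF 1) := rfl
    have hpdf : ∀ r, Measurable (exponentialPDF r) := fun r =>
      (measurable_exponentialPDFReal r).ennreal_ofReal
    rw [hd, lintegral_withDensity_eq_lintegral_mul _ (hpdf 1) hm]
    have h2 : ∀ z : ℝ, (exponentialPDF 1 * fun z : ℝ => ENNReal.ofReal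
        (expNeg (ENNReal.ofReal (c * z)))) z =
        ENNReal.ofReal (1 / (1 + c)) * exponentialPDF (1 + c) z := by
      intro z
      rw [Pi.mul_apply]
      rcases lt_or_ge z 0 with hz | hz
      · rw [exponentialPDF_of_neg hz, exponentialPDF_of_neg hz, zero_mul, mul_zero]
      · rw [exponentialPDF_of_nonneg hz, exponentialPDF_of_nonneg hz,
          expNeg_ofReal (mul_nonneg hc hz), ← ENNReal.ofReal_mul (by positivity),
          ← ENNReal.ofReal_mul (by positivity), ← mul_assoc, one_div_mul_cancel (by positivity)]
        simp only [one_mul]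
        rw [← Real.exp_add]
        congr 2
        ring
    rw [lintegral_congr h2, lintegral_const_mul _ (hpdf _),
      lintegral_exponentialPDF_eq_one (by positivity), mul_one]
  rw [integral_eq_lintegral_of_nonneg_ae (.of_forall fun _ => expNeg_nonneg _)
    (measurable_expNeg.comp (by fun_prop)).aestronglyMeasurable, h1,
    ENNReal.toReal_ofReal (by positivity)]

end Exponential

/-! ### Consequences of independence -/

section Independence

variable {Ω : Type*} [mΩ : MeasurableSpace Ω] {μ : Measure Ω} [IsProbabilityMeasure μ]

lemma integral_expNeg_tsum_of_indep {G : ℕ → Ω → ℝ≥0∞} (hG : ∀ m, Measurable (G m))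
    (hind : iIndepFun G μ) {L : ℕ → ℝ≥0∞} (hL : ∀ m, ∫ ω, expNeg (G m ω) ∂μ = expNeg (L m)) :
    ∫ ω, expNeg (∑' m, G m ω) ∂μ = expNeg (∑' m, L m) := by
  have h1 : Tendsto (fun N => ∫ ω, expNeg (∑ m ∈ Finset.range N, G m ω) ∂μ) atTop
      (𝓝 (∫ ω, expNeg (∑' m, G m ω) ∂μ)) := by
    refine tendsto_integral_of_dominated_convergence (fun _ => 1) (fun m => ?_)
      (integrable_const _) (fun m => .of_forall fun ω => ?_) (.of_forall fun ω => ?_)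
    · exact (measurable_expNeg.comp
        (Finset.measurable_fun_sum _ fun n _ => hG n)).aestronglyMeasurable
    · rw [Real.norm_of_nonneg (expNeg_nonneg _)]
      exact expNeg_le_one _
    · exact (continuous_expNeg.tendsto _).comp (ENNReal.tendsto_nat_tsum _)
  have h2 : Tendsto (fun N => expNeg (∑ m ∈ Finset.range N, L m)) atTop
      (𝓝 (expNeg (∑' m, L m))) :=
    (continuous_expNeg.tendsto _).comp (ENNReal.tendsto_nat_tsum _)
  refine tendsto_nhds_unique h1 (h2.congr fun N => ?_)
  have h3 := (hind.precomp (g := fun k : Fin N => (k : ℕ)) Fin.val_injective).integral_fun_prod_comp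
    (f := fun _ => expNeg) (fun k => (hG k).aemeasurable)
    fun k => measurable_expNeg.aestronglyMeasurable
  simp_rw [expNeg_sum, Finset.prod_range, ← hL]
  exact h3.symm

/-- Integrating over `Z` first, with `Y` fixed, leaves the exponential tail `exp (-Y)`. -/
lemma measure_lt_ofReal_of_indep {Y : Ω → ℝ≥0∞} {Z : Ω → ℝ} (hY : Measurable Y)
    (hZ : Measurable Z) (hlaw : μ.map Z = expMeasure 1) (hind : IndepFun Y Z μ) :
    μ {ω | Y ω < ENNReal.ofReal (Z ω)} = ENNReal.ofReal (∫ ω, expNeg (Y ω) ∂μ) := by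
  have := isProbabilityMeasure_expMeasure one_pos
  have hm : MeasurableSet {q : ℝ≥0∞ × ℝ | q.1 < ENNReal.ofReal q.2} :=
    measurableSet_lt measurable_fst (ENNReal.measurable_ofReal.comp measurable_snd)
  have h1 : μ {ω | Y ω < ENNReal.ofReal (Z ω)} =
      (μ.map fun ω => (Y ω, Z ω)) {q | q.1 < ENNReal.ofReal q.2} := by
    rw [Measure.map_apply (hY.prodMk hZ) hm]
    rfl
  rw [h1, (indepFun_iff_map_prod_eq_prod_map_map hY.aemeasurable hZ.aemeasurable).1 hind, hlaw,
    Measure.prod_apply hm]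
  have h2 : ∀ y : ℝ≥0∞, expMeasure 1 (Prod.mk y ⁻¹' {q : ℝ≥0∞ × ℝ | q.1 < ENNReal.ofReal q.2}) =
      ENNReal.ofReal (expNeg y) := expMeasure_lt_ofReal
  rw [lintegral_congr h2, lintegral_map (f := fun y => ENNReal.ofReal (expNeg y))
      (ENNReal.measurable_ofReal.comp measurable_expNeg) hY,
    ofReal_integral_eq_lintegral_ofReal]
  · exact integrable_of_unit_bounds (measurable_expNeg.comp hY) (fun _ => expNeg_nonneg _)
      fun _ => expNeg_le_one _
  · exact .of_forall fun _ => expNeg_nonneg _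

/-- Events depending on disjoint blocks of independent σ-algebras are independent. -/
lemma measure_biInter_of_disjoint_blocks {ι β : Type*} {m : ι → MeasurableSpace Ω}
    (hle : ∀ a, m a ≤ mΩ) (hind : iIndep m μ) {T : β → Set ι}
    (hT : Pairwise fun b c => Disjoint (T b) (T c)) {E : β → Set Ω}
    (hE : ∀ b, MeasurableSet[⨆ a ∈ T b, m a] (E b)) (s : Finset β) :
    μ (⋂ b ∈ s, E b) = ∏ b ∈ s, μ (E b) := by
  classical
  induction s using Finset.induction_on with
  | empty => simp
  | insert b s hb ih =>
    rw [Finset.prod_insert hb, ← ih, Finset.set_biInter_insert]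
    have hdis : Disjoint (T b) (⋃ c ∈ s, T c) := by
      rw [Set.disjoint_iUnion₂_right]
      exact fun c hc => hT fun h => hb (h ▸ hc)
    refine (Indep_iff _ _ _).1 (indep_iSup_of_disjoint hle hind hdis) _ _ (hE b) ?_
    refine Finset.measurableSet_biInter (m := ⨆ a ∈ ⋃ c ∈ s, T c, m a) s fun c hc => ?_
    have hsub : (⨆ a ∈ T c, m a) ≤ ⨆ a ∈ ⋃ c ∈ s, T c, m a :=
      biSup_mono fun a ha => Set.mem_biUnion hc ha
    exact hsub _ (hE c)

end Independence

/-! ### Detection for a fixed configuration -/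

section Fading

variable {Ω : Type*} [mΩ : MeasurableSpace Ω] {μ : Measure Ω} [IsProbabilityMeasure μ]
  {p : Params} {F : ℕ → ℕ → Ω → ℝ} {M : ℕ} {x : ℕ → ℂ}

/-- The σ-algebra generated by the fading of one link in one cycle. -/
abbrev fadingSigma (F : ℕ → ℕ → Ω → ℝ) (a : ℕ × ℕ) : MeasurableSpace Ω :=
  MeasurableSpace.comap (fun ω => F a.1 a.2 ω) inferInstance

omit mΩ in
lemma measurable_fading_iSup {T : Set (ℕ × ℕ)} {a : ℕ × ℕ} (ha : a ∈ T) :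
    Measurable[⨆ a ∈ T, fadingSigma F a] (F a.1 a.2) :=
  (comap_measurable (F a.1 a.2)).mono (le_iSup₂ (f := fun a _ => fadingSigma F a) a ha) le_rfl

omit mΩ in
lemma measurable_rxPower_const {m : MeasurableSpace Ω} {t n : ℕ} (h : Measurable (F t n)) :
    Measurable (rxPower p (fun n (_ : Ω) => x n) F t n) :=
  ENNReal.measurable_ofReal.comp (h.div_const _)

omit mΩ in
lemma measurableSet_sectorDetected_block (i : Fin M) (t : ℕ) :
    MeasurableSet[⨆ a ∈ {a : ℕ × ℕ | a.1 = t ∧ x a.2 ∈ sector M i}, fadingSigma F a]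
      {ω | SectorDetected p (fun n _ => x n) F M i t ω} := by
  classical
  refine @measurableSet_sectorDetected_of_rxPower Ω _ p (fun n _ => x n) F M
    (fun n => measurable_const) i t fun n => ?_
  by_cases hn : x n ∈ sector M i
  · simp only [if_pos hn]
    exact measurable_rxPower_const (measurable_fading_iSup (F := F) (a := (t, n)) ⟨rfl, hn⟩)
  · simp only [if_neg hn]
    exact measurable_const

omit mΩ in
lemma sectorDetected_iff_of_nearest (hp : p.Admissible) {i : Fin M} {n : ℕ}
    (hn : x n ∈ sector M i) (hmin : ∀ m, x m ∈ sector M i → m ≠ n → ‖x n‖ < ‖x m‖) (t : ℕ)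
    (ω : Ω) : SectorDetected p (fun n _ => x n) F M i t ω ↔
      ENNReal.ofReal (p.Gam * p.pathLoss ‖x n‖) *
        (interference p (fun n _ => x n) F M i t n ω + ENNReal.ofReal (p.W / (p.P * M))) <
        ENNReal.ofReal (F t n ω) := by
  have hl := hp.pathLoss_pos (norm_pos_iff.2 hn.1)
  have h1 : SectorDetected p (fun n _ => x n) F M i t ω ↔
      ENNReal.ofReal p.Gam < sinr p (fun n _ => x n) F M i t n ω := by
    constructor
    · rintro ⟨m, ⟨hm, hm'⟩, h⟩
      have : m = n := by
        by_contra hmn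
        exact absurd (hmin m hm hmn) (not_lt.2 (hm' n hn))
      rwa [this] at h
    · refine fun h => ⟨n, ⟨hn, fun m hm => ?_⟩, h⟩
      by_cases hmn : m = n
      · rw [hmn]
      · exact (hmin m hm hmn).le
  -- When `b = ∞` both sides are false. The value `b = 0`, which occurs without noise and
  -- interference, is not excluded.
  have hlt : ∀ a b c : ℝ≥0∞, a ≠ 0 → a ≠ ∞ → (a < c / b ↔ a * b < c) := by
    intro a b c ha ha'
    by_cases hb : b = ∞
    · simp [hb, ha]
    · exact ENNReal.lt_div_iff_mul_lt (Or.inr ha') (Or.inl hb)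
  have hG : ENNReal.ofReal p.Gam ≠ 0 := by simpa using hp.Gam_pos
  rw [h1, sinr, hlt _ _ _ hG ENNReal.ofReal_ne_top, rxPower, ENNReal.ofReal_div_of_pos hl,
    ENNReal.lt_div_iff_mul_lt (Or.inl (by simpa using hl)) (Or.inl ENNReal.ofReal_ne_top),
    ENNReal.ofReal_mul hp.Gam_pos.le]
  rw [mul_right_comm]

/-- For a fixed configuration, `detProb` is the detection probability. -/
lemma measure_sectorDetected (hp : p.Admissible) (hF : ∀ t n, Measurable (F t n))
    (hlaw : ∀ t n, μ.map (F t n) = expMeasure 1)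
    (hind : iIndepFun (fun (a : ℕ × ℕ) ω => F a.1 a.2 ω) μ) (hx : Regular M x) (i : Fin M)
    (t : ℕ) : μ {ω | SectorDetected p (fun n _ => x n) F M i t ω} =
      ENNReal.ofReal (detProb p M i x) := by
  classical
  obtain ⟨n, hn, hmin⟩ := hx.2 i
  have hxn := norm_pos_iff.2 hn.1
  have hl := hp.pathLoss_pos hxn
  have hΓ := hp.Gam_pos
  let c : ℝ≥0∞ := ENNReal.ofReal (p.Gam * p.pathLoss ‖x n‖)
  let G : ℕ → Ω → ℝ≥0∞ := fun m ω =>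
    if m ≠ n ∧ x m ∈ sector M i then c * rxPower p (fun n _ => x n) F t m ω else 0
  let L : ℕ → ℝ≥0∞ := fun m =>
    if m ≠ n ∧ x m ∈ sector M i then p.logGain ‖x n‖ ‖x m‖ else 0
  -- Cleared of denominators, detection says that the fading of the nearest point exceeds `Y`. The
  -- noise part of `Y` is deterministic and the interference part is a sum of independent terms,
  -- each with Laplace transform `1 / (1 + Γ l(‖x n‖) / l(‖x m‖))`.
  let Y : Ω → ℝ≥0∞ := fun ω => (∑' m, G m ω) + c * ENNReal.ofReal (p.W / (p.P * M))
  have hYmeas : ∀ m : MeasurableSpace Ω, (∀ k, k ≠ n → Measurable[m] (F t k)) → Measurable[m] Y := by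
    intro m hm
    refine Measurable.add_const (Measurable.tsum fun k => ?_) _
    by_cases hk : k ≠ n ∧ x k ∈ sector M i
    · simp only [G, if_pos hk]
      exact (measurable_rxPower_const (hm k hk.1)).const_mul _
    · simp only [G, if_neg hk]
      exact measurable_const
  have hset : {ω | SectorDetected p (fun n _ => x n) F M i t ω} =
      {ω | Y ω < ENNReal.ofReal (F t n ω)} := by
    ext ω
    rw [Set.mem_ofPred_eq, sectorDetected_iff_of_nearest hp hn hmin, mul_add, interference,
      ← ENNReal.tsum_mul_left]
    simp only [mul_ite, mul_zero]
    rfl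
  -- `Y` involves only the links other than `n`, and the fading variables are independent over
  -- links.
  have hindep : IndepFun Y (F t n) μ := by
    have h1 := indep_iSup_of_disjoint (fun a => (hF a.1 a.2).comap_le)
      ((iIndepFun_iff_iIndep _ _ _).1 hind)
      (S := {a | a ≠ (t, n)}) (T := {(t, n)}) (by simp)
    rw [IndepFun_iff_Indep]
    refine indep_of_indep_of_le_left (indep_of_indep_of_le_right h1 ?_) ?_
    · exact (measurable_fading_iSup (F := F) (T := {(t, n)}) (a := (t, n)) (Set.mem_singleton _)).comap_le
    · refine (hYmeas _ fun k hk => ?_).comap_le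
      exact measurable_fading_iSup (F := F) (a := (t, k)) (by simpa using hk)
  have hGm : ∀ m, Measurable (G m) := by
    intro m
    by_cases hm : m ≠ n ∧ x m ∈ sector M i
    · simp only [G, if_pos hm]
      exact (measurable_rxPower_const (hF t m)).const_mul _
    · simp only [G, if_neg hm]
      exact measurable_const
  have hGind : iIndepFun G μ := by
    have h1 := hind.precomp (g := fun m : ℕ => (t, m)) (Prod.mk_right_injective t)
    exact h1.comp (fun m z => if m ≠ n ∧ x m ∈ sector M i then
      c * ENNReal.ofReal (z / p.pathLoss ‖x m‖) else 0) fun m => by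
        split_ifs <;> fun_prop
  have hGL : ∀ m, ∫ ω, expNeg (G m ω) ∂μ = expNeg (L m) := by
    intro m
    by_cases hm : m ≠ n ∧ x m ∈ sector M i
    · simp only [G, L, if_pos hm]
      have hxm := norm_pos_iff.2 hm.2.1
      have hg := hp.gain_nonneg hxn hxm
      have h1 : ∀ ω, c * rxPower p (fun n _ => x n) F t m ω =
          ENNReal.ofReal (p.Gam * p.pathLoss ‖x n‖ / p.pathLoss ‖x m‖ * F t m ω) := by
        intro ω
        simp only [c, rxPower]
        rw [← ENNReal.ofReal_mul (by positivity)]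
        congr 1
        ring
      have h2 : ∫ ω, expNeg (ENNReal.ofReal
          (p.Gam * p.pathLoss ‖x n‖ / p.pathLoss ‖x m‖ * F t m ω)) ∂μ =
          ∫ z, expNeg (ENNReal.ofReal (p.Gam * p.pathLoss ‖x n‖ / p.pathLoss ‖x m‖ * z))
            ∂(μ.map (F t m)) := by
        rw [integral_map (hF t m).aemeasurable]
        exact (measurable_expNeg.comp (by fun_prop)).aestronglyMeasurable
      have h3 := hp.expNeg_logGain hxn hxm 1
      rw [Nat.cast_one, one_mul, pow_one] at h3
      simp_rw [h1]
      rw [h2, hlaw, integral_expNeg_expMeasure hg, h3]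
    · simp [G, L, if_neg hm]
  have hLsum : ∑' m, L m = sectorSum M i ((Set.Ioi ‖x n‖).indicator (p.logGain ‖x n‖)) x := by
    refine tsum_congr fun m => ?_
    by_cases hm : x m ∈ sector M i
    · rw [Set.indicator_of_mem hm]
      by_cases hmn : m = n
      · simp [L, hmn]
      · rw [Set.indicator_of_mem (Set.mem_Ioi.2 (hmin m hm hmn))]
        simp [L, hmn, hm]
    · rw [Set.indicator_of_notMem hm]
      simp [L, hm]
  rw [hset, measure_lt_ofReal_of_indep (hYmeas _ fun k _ => hF t k) (hF t n) (hlaw t n) hindep]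
  congr 1
  simp only [Y, expNeg_add]
  rw [integral_mul_const, integral_expNeg_tsum_of_indep hGm hGind hGL, hLsum, detProb,
    minDist_eq_of_nearest hn hmin, mul_comm]
  congr 1
  have hP := hp.P_pos
  have hW := hp.W_nonneg
  simp only [c]
  rw [← ENNReal.ofReal_mul (by positivity), expNeg_ofReal (by positivity)]
  congr 2
  ring

/-- For a fixed configuration, the detections of different sectors in different cycles are
independent. -/
theorem measure_iInter_undetected (hp : p.Admissible) (hF : ∀ t n, Measurable (F t n))
    (hlaw : ∀ t n, μ.map (F t n) = expMeasure 1)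
    (hind : iIndepFun (fun (a : ℕ × ℕ) ω => F a.1 a.2 ω) μ) (hx : Regular M x) (j : Fin M → ℕ) :
    μ (⋂ i, undetected p (fun n _ => x n) F M i (j i)) =
      ENNReal.ofReal (∏ i, (1 - detProb p M i x) ^ j i) := by
  -- The pairs of a sector and a cycle; since cycles are numbered from `1`, sector `i` contributes
  -- exactly `j i` pairs.
  let s : Finset ((_ : Fin M) × ℕ) := Finset.univ.sigma fun i => Finset.Icc 1 (j i)
  have hset : ⋂ i, undetected p (fun n (_ : Ω) => x n) F M i (j i) =
      ⋂ b ∈ s, {ω | SectorDetected p (fun n _ => x n) F M b.1 b.2 ω}ᶜ := by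
    ext ω
    simp [undetected, s, Sigma.forall]
  have hblock := measure_biInter_of_disjoint_blocks (m := fadingSigma F)
    (fun a => (hF a.1 a.2).comap_le) ((iIndepFun_iff_iIndep _ _ _).1 hind)
    (T := fun b : (_ : Fin M) × ℕ => {a : ℕ × ℕ | a.1 = b.2 ∧ x a.2 ∈ sector M b.1})
    (by
      rintro ⟨i, t⟩ ⟨i', t'⟩ hne
      rw [Set.disjoint_left]
      rintro a ⟨h1, h2⟩ ⟨h3, h4⟩
      refine hne ?_
      have h5 : t = t' := h1.symm.trans h3
      have h6 : i = i' := by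
        by_contra h
        exact Set.disjoint_left.1 (pairwise_disjoint_sector M h) h2 h4
      rw [h5, h6])
    (fun b => (measurableSet_sectorDetected_block (p := p) (F := F) (x := x) b.1 b.2).compl) s
  rw [hset, hblock, Finset.prod_sigma, ENNReal.ofReal_prod_of_nonneg]
  · refine Finset.prod_congr rfl fun i _ => ?_
    have h0 : 0 ≤ 1 - detProb p M i x := sub_nonneg.2 (detProb_le_one hp i hx)
    have h1 : ∀ t, μ {ω | SectorDetected p (fun n _ => x n) F M i t ω}ᶜ =
        ENNReal.ofReal (1 - detProb p M i x) := by
      intro t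
      rw [prob_compl_eq_one_sub (measurableSet_sectorDetected (fun n => measurable_const) hF i t),
        measure_sectorDetected hp hF hlaw hind hx i t, ENNReal.ofReal_sub _ (detProb_nonneg p M i x),
        ENNReal.ofReal_one]
    simp_rw [h1]
    rw [Finset.prod_const, Nat.card_Icc, Nat.add_sub_cancel, ENNReal.ofReal_pow h0]
  · intro i _
    exact pow_nonneg (sub_nonneg.2 (detProb_le_one hp i hx)) _

end Fading

/-! ### Conditional probabilities and the mean number of cycles -/

section Conditional

variable {Ω : Type*} [MeasurableSpace Ω] {μ : Measure Ω} [IsProbabilityMeasure μ]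
  {p : Params} {X : ℕ → Ω → ℂ} {F : ℕ → ℕ → Ω → ℝ} {M : ℕ}

lemma measurable_nearestDist (hX : ∀ n, Measurable (X n)) : Measurable (nearestDist X M) :=
  measurable_pi_lambda _ fun i => (measurable_minDist M i).comp (measurable_pi_lambda _ hX)

/-- Conditioning on the locations: the fading is independent of the configuration. -/
theorem measure_inter_iInter_undetected (hp : p.Admissible) (hnet : IsNetwork p X F μ)
    (j : Fin M → ℕ) {A : Set (Fin M → ℝ)} (hA : MeasurableSet A) :
    μ (nearestDist X M ⁻¹' A ∩ ⋂ i, undetected p X F M i (j i)) =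
      ∫⁻ ω in nearestDist X M ⁻¹' A,
        ENNReal.ofReal (∏ i, (1 - detProb p M i fun n => X n ω) ^ j i) ∂μ := by
  have hXm : Measurable fun ω (n : ℕ) => X n ω := measurable_pi_lambda _ hnet.measurable_loc
  have hFm : Measurable fun ω (a : ℕ × ℕ) => F a.1 a.2 ω :=
    measurable_pi_lambda _ fun a => hnet.measurable_fading a.1 a.2
  -- The event is transported to the product of the spaces of configurations and of fadings. There
  -- the joint law is a product measure, and Fubini's theorem integrates the fading with the
  -- configuration fixed.
  let X' : ℕ → (ℕ → ℂ) × (ℕ × ℕ → ℝ) → ℂ := fun n q => q.1 n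
  let F' : ℕ → ℕ → (ℕ → ℂ) × (ℕ × ℕ → ℝ) → ℝ := fun t n q => q.2 (t, n)
  have hX' : ∀ n, Measurable (X' n) := fun n => (measurable_pi_apply n).comp measurable_fst
  have hF' : ∀ t n, Measurable (F' t n) := fun t n =>
    (measurable_pi_apply (t, n)).comp measurable_snd
  let S : Set ((ℕ → ℂ) × (ℕ × ℕ → ℝ)) :=
    nearestDist X' M ⁻¹' A ∩ ⋂ i, undetected p X' F' M i (j i)
  have hS : MeasurableSet S := (measurable_nearestDist hX' hA).inter
    (MeasurableSet.iInter fun i => measurableSet_undetected hX' hF' i (j i))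
  have h1 : μ (nearestDist X M ⁻¹' A ∩ ⋂ i, undetected p X F M i (j i)) =
      (μ.map fun ω => ((fun n => X n ω), fun a : ℕ × ℕ => F a.1 a.2 ω)) S := by
    rw [Measure.map_apply (hXm.prodMk hFm) hS]
    congr 1
    ext ω
    simp only [S, Set.mem_inter_iff, Set.mem_preimage, Set.mem_iInter]
    rfl
  have hprob : IsProbabilityMeasure (μ.map fun ω (a : ℕ × ℕ) => F a.1 a.2 ω) :=
    Measure.isProbabilityMeasure_map hFm.aemeasurable
  rw [h1, (indepFun_iff_map_prod_eq_prod_map_map hXm.aemeasurable hFm.aemeasurable).1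
    hnet.fading_indep_loc, Measure.prod_apply hS,
    lintegral_map (measurable_measure_prodMk_left hS) hXm,
    ← lintegral_indicator (measurable_nearestDist hnet.measurable_loc hA)]
  refine lintegral_congr_ae ?_
  filter_upwards [ae_regular hnet.measurable_loc hnet.injective_loc hnet.poisson hp.lam_pos M]
    with ω hω
  rw [Measure.map_apply hFm (measurable_prodMk_left hS)]
  by_cases h : nearestDist X M ω ∈ A
  · rw [Set.indicator_of_mem (show ω ∈ nearestDist X M ⁻¹' A from h),
      ← measure_iInter_undetected hp hnet.measurable_fading hnet.fading_law hnet.fading_indep hω j]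
    congr 1
    ext η
    have h' : nearestDist X' M ((fun n => X n ω), fun a : ℕ × ℕ => F a.1 a.2 η) ∈ A := h
    simp only [S, Set.mem_inter_iff, Set.mem_preimage, Set.mem_iInter, h', true_and]
    rfl
  · rw [Set.indicator_of_notMem (show ω ∉ nearestDist X M ⁻¹' A from h)]
    refine measure_mono_null ?_ measure_empty
    intro η hη
    exact absurd hη.1 h

theorem measureReal_inter_iInter_undetected (hp : p.Admissible) (hnet : IsNetwork p X F μ)
    (j : Fin M → ℕ) {A : Set (Fin M → ℝ)} (hA : MeasurableSet A) :
    μ.real (nearestDist X M ⁻¹' A ∩ ⋂ i, undetected p X F M i (j i)) =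
      ∫ ω in nearestDist X M ⁻¹' A, ∏ i, p.f M (j i) (nearestDist X M ω i) ∂μ := by
  have hXm : Measurable fun ω (n : ℕ) => X n ω := measurable_pi_lambda _ hnet.measurable_loc
  rw [← setIntegral_prod_one_sub_detProb_pow hp hnet.measurable_loc hnet.injective_loc
    hnet.poisson j hA, measureReal_def, measure_inter_iInter_undetected hp hnet j hA,
    integral_eq_lintegral_of_nonneg_ae]
  · refine ae_restrict_of_ae ?_
    filter_upwards [ae_regular hnet.measurable_loc hnet.injective_loc hnet.poisson hp.lam_pos M]
      with ω hω
    exact Finset.prod_nonneg fun i _ => pow_nonneg (sub_nonneg.2 (detProb_le_one hp i hω)) _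
  · exact (Finset.measurable_fun_prod _ fun i _ => (measurable_const.sub
      ((measurable_detProb p M i).comp hXm)).pow_const _).aestronglyMeasurable

omit [MeasurableSpace Ω] in
lemma measurable_f_nearestDist (i : Fin M) (j : ℕ) :
    Measurable[distSigma X M] fun ω => p.f M j (nearestDist X M ω i) := by
  have h : Measurable fun r : Fin M → ℝ => p.f M j (r i) :=
    (measurable_f p M j).comp (measurable_pi_apply i)
  exact h.comp (comap_measurable (nearestDist X M))

lemma distSigma_le (hX : ∀ n, Measurable (X n)) :
    distSigma X M ≤ (inferInstance : MeasurableSpace Ω) :=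
  (measurable_nearestDist hX).comap_le

lemma integrable_prod_f (hp : p.Admissible) (hnet : IsNetwork p X F μ) (j : Fin M → ℕ) :
    Integrable (fun ω => ∏ i, p.f M (j i) (nearestDist X M ω i)) μ := by
  refine Integrable.of_bound (C := ∏ i, 2 ^ j i) ?_ ?_
  · exact (Finset.measurable_fun_prod _ fun i _ => (measurable_f_nearestDist i (j i)).mono
      (distSigma_le hnet.measurable_loc) le_rfl).aestronglyMeasurable
  · filter_upwards [ae_regular hnet.measurable_loc hnet.injective_loc hnet.poisson hp.lam_pos M]
      with ω hω
    rw [norm_prod]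
    exact Finset.prod_le_prod (fun i _ => norm_nonneg _) fun i _ =>
      abs_f_le hp (j i) (hω.minDist_pos i)

/-- The conditional probability that sector `i` is not detected in `j i` cycles, for all `i`. -/
theorem condExp_iInter_undetected (hp : p.Admissible) (hnet : IsNetwork p X F μ)
    (j : Fin M → ℕ) :
    condExp (distSigma X M) μ
        ((⋂ i, undetected p X F M i (j i)).indicator fun _ => (1 : ℝ)) =ᵐ[μ]
      fun ω => ∏ i, p.f M (j i) (nearestDist X M ω i) := by
  have hU : MeasurableSet (⋂ i, undetected p X F M i (j i)) := MeasurableSet.iInter fun i =>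
    measurableSet_undetected hnet.measurable_loc hnet.measurable_fading i (j i)
  refine (ae_eq_condExp_of_forall_setIntegral_eq (distSigma_le hnet.measurable_loc)
    ((integrable_const 1).indicator hU)
    (fun s _ _ => (integrable_prod_f hp hnet j).integrableOn) ?_ ?_).symm
  · rintro s ⟨A, hA, rfl⟩ -
    rw [← measureReal_inter_iInter_undetected hp hnet j hA, setIntegral_indicator hU,
      setIntegral_const, smul_eq_mul, mul_one]
  · exact (Finset.measurable_fun_prod _ fun i _ =>
      measurable_f_nearestDist i (j i)).stronglyMeasurable.aestronglyMeasurable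

theorem condExp_undetected (hp : p.Admissible) (hnet : IsNetwork p X F μ) (i : Fin M) (j : ℕ) :
    condExp (distSigma X M) μ ((undetected p X F M i j).indicator fun _ => (1 : ℝ)) =ᵐ[μ]
      fun ω => p.f M j (nearestDist X M ω i) := by
  -- With zero cycles required of the other sectors, their events are the whole space and their
  -- factors are `f_0 = 1`.
  have h := condExp_iInter_undetected hp hnet (Pi.single i j)
  have h0 : ∀ i', undetected p X F M i' 0 = Set.univ := by
    intro i'
    refine Set.eq_univ_of_forall fun ω t h1 h2 => ?_
    omega
  have hset : ⋂ i', undetected p X F M i' ((Pi.single i j : Fin M → ℕ) i') = undetected p X F M i j := by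
    refine Set.Subset.antisymm (fun ω hω => ?_) fun ω hω => Set.mem_iInter.2 fun i' => ?_
    · simpa using Set.mem_iInter.1 hω i
    · by_cases hi : i' = i
      · subst hi
        simpa using hω
      · rw [Pi.single_eq_of_ne hi, h0]
        exact Set.mem_univ ω
  have hprod : ∀ ω, ∏ i', p.f M ((Pi.single i j : Fin M → ℕ) i') (nearestDist X M ω i') =
      p.f M j (nearestDist X M ω i) := by
    intro ω
    rw [Finset.prod_eq_single i]
    · rw [Pi.single_eq_same]
    · intro i' _ hi
      rw [Pi.single_eq_of_ne hi, f_zero]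
    · simp
  simpa only [hset, hprod] using h

/-- The sign is not visible on an alternating sum; it follows from the identification with a
conditional probability. -/
lemma ae_f_nonneg (hp : p.Admissible) (hnet : IsNetwork p X F μ) :
    ∀ᵐ ω ∂μ, ∀ (i : Fin M) (j : ℕ), 0 ≤ p.f M j (nearestDist X M ω i) := by
  refine ae_all_iff.2 fun i => ae_all_iff.2 fun j => ?_
  have h : 0 ≤ᵐ[μ] condExp (distSigma X M) μ
      ((undetected p X F M i j).indicator fun _ => (1 : ℝ)) :=
    condExp_nonneg (.of_forall fun ω => Set.indicator_nonneg (fun _ _ => zero_le_one) ω)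
  filter_upwards [h, condExp_undetected hp hnet i j] with ω h1 h2
  rw [← h2]
  exact h1

omit [MeasurableSpace Ω] in
/-- The number of cycles is the number of `j` such that the first `j` cycles fail. -/
lemma numCycles_eq_tsum (ω : Ω) : numCycles p X F M ω =
    ∑' j, (⋂ i, undetected p X F M i j).indicator (fun _ => (1 : ℝ≥0∞)) ω := by
  classical
  have hmem : ∀ j, ω ∈ ⋂ i, undetected p X F M i j ↔
      ∀ t, 1 ≤ t → t ≤ j → ¬ CellSearchSuccess p X F M t ω := by
    intro j
    simp only [Set.mem_iInter, undetected, Set.mem_ofPred_eq, CellSearchSuccess, not_exists]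
    exact ⟨fun h t h1 h2 i => h i t h1 h2, fun h i t h1 h2 => h t h1 h2 i⟩
  by_cases hex : ∃ t, 1 ≤ t ∧ CellSearchSuccess p X F M t ω
  · have hspec := Nat.find_spec hex
    have hmin : ∀ t, 1 ≤ t → CellSearchSuccess p X F M t ω → Nat.find hex ≤ t := fun t h1 h2 =>
      Nat.find_min' hex ⟨h1, h2⟩
    have h1 : numCycles p X F M ω = (Nat.find hex : ℝ≥0∞) := by
      refine le_antisymm (iInf₂_le (f := fun (t : ℕ) _ => (t : ℝ≥0∞)) _ hspec) (le_iInf₂ fun t ht => ?_)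
      exact_mod_cast hmin t ht.1 ht.2
    -- If `T` is the first successful cycle, the first `j` cycles fail exactly for `j = 0, …, T -
    -- 1`, which are `T` values.
    have h2 : ∀ j, (⋂ i, undetected p X F M i j).indicator (fun _ => (1 : ℝ≥0∞)) ω =
        if j < Nat.find hex then 1 else 0 := by
      intro j
      rw [Set.indicator_apply]
      refine if_congr ((hmem j).trans ⟨fun h => ?_, fun h t h1 h2 h3 => ?_⟩) rfl rfl
      · by_contra hj
        exact h _ hspec.1 (not_lt.1 hj) hspec.2
      · exact absurd (hmin t h1 h3) (not_le.2 (h2.trans_lt h))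
    rw [h1, tsum_congr h2, tsum_eq_sum (s := Finset.range (Nat.find hex))]
    · rw [Finset.sum_congr rfl fun j hj => if_pos (Finset.mem_range.1 hj)]
      simp
    · intro j hj
      exact if_neg (by simpa using hj)
  · have h1 : numCycles p X F M ω = ∞ := by
      refine top_le_iff.1 (le_iInf₂ fun t ht => absurd ⟨t, ht⟩ hex)
    have h2 : ∀ j, (⋂ i, undetected p X F M i j).indicator (fun _ => (1 : ℝ≥0∞)) ω = 1 := by
      intro j
      refine Set.indicator_of_mem ((hmem j).2 fun t ht _ hs => hex ⟨t, ht, hs⟩) _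
    rw [h1, tsum_congr h2, ENNReal.tsum_const_eq_top_of_ne_zero one_ne_zero]

/-- Tonelli's theorem exchanges the series with the integral over each event of `distSigma`, even if
the mean is infinite. The terms then agree by the joint formula with the same `j` in every sector.
-/
theorem condLExp_numCycles (hp : p.Admissible) (hnet : IsNetwork p X F μ) :
    condLExp (distSigma X M) μ (numCycles p X F M) =ᵐ[μ] fun ω =>
      ∑' j : ℕ, ∏ i : Fin M, ENNReal.ofReal (p.f M j (nearestDist X M ω i)) := by
  have hle : distSigma X M ≤ _ := distSigma_le hnet.measurable_loc
  have hg : ∀ j, Measurable fun r : Fin M → ℝ => ∏ i : Fin M, ENNReal.ofReal (p.f M j (r i)) :=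
    fun j => Finset.measurable_fun_prod _ fun i _ =>
      ENNReal.measurable_ofReal.comp ((measurable_f p M j).comp (measurable_pi_apply i))
  have hgR : ∀ j, Measurable fun ω =>
      ∏ i : Fin M, ENNReal.ofReal (p.f M j (nearestDist X M ω i)) := fun j =>
    (hg j).comp (measurable_nearestDist hnet.measurable_loc)
  have hU : ∀ j, MeasurableSet (⋂ i, undetected p X F M i j) := fun j =>
    MeasurableSet.iInter fun i =>
      measurableSet_undetected hnet.measurable_loc hnet.measurable_fading i j
  refine (ae_eq_condLExp hle μ _ ((Measurable.tsum hg).comp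
    (comap_measurable (nearestDist X M))) ?_).symm
  rintro s ⟨A, hA, rfl⟩
  simp_rw [numCycles_eq_tsum, Function.comp_apply]
  rw [lintegral_tsum fun j => (hgR j).aemeasurable,
    lintegral_tsum fun j => (measurable_const.indicator (hU j)).aemeasurable]
  refine tsum_congr fun j => ?_
  have hnn := ae_f_nonneg (M := M) hp hnet
  -- Moving `ENNReal.ofReal` outside the product uses that all factors are nonnegative, which is
  -- known almost surely.
  have h1 : ∫⁻ ω in nearestDist X M ⁻¹' A,
      ∏ i : Fin M, ENNReal.ofReal (p.f M j (nearestDist X M ω i)) ∂μ =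
      ∫⁻ ω in nearestDist X M ⁻¹' A,
        ENNReal.ofReal (∏ i : Fin M, p.f M j (nearestDist X M ω i)) ∂μ := by
    refine lintegral_congr_ae (ae_restrict_of_ae ?_)
    filter_upwards [hnn] with ω hω
    rw [ENNReal.ofReal_prod_of_nonneg fun i _ => hω i j]
  rw [h1, ← ofReal_integral_eq_lintegral_ofReal (integrable_prod_f hp hnet fun _ => j).integrableOn
    (ae_restrict_of_ae (hnn.mono fun ω hω => Finset.prod_nonneg fun i _ => hω i j)),
    ← measureReal_inter_iInter_undetected hp hnet (fun _ => j) hA, ofReal_measureReal,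
    setLIntegral_indicator (hU j), setLIntegral_const, one_mul, Set.inter_comm]

end Conditional

end CellSearch

end

theorem mainTheorem10 {Ω : Type*} [MeasurableSpace Ω] (μ : MeasureTheory.Measure Ω)
    [MeasureTheory.IsProbabilityMeasure μ] (p : CellSearch.Params) (hp : p.Admissible)
    (X : ℕ → Ω → ℂ) (F : ℕ → ℕ → Ω → ℝ) (hnet : CellSearch.IsNetwork p X F μ)
    (M : ℕ) (hM : 1 ≤ M) :
    (∀ (i : Fin M) (j : ℕ),
      MeasureTheory.condExp (CellSearch.distSigma X M) μ
          (Set.indicator (CellSearch.undetected p X F M i j) fun _ => (1 : ℝ))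
        =ᵐ[μ] fun ω => p.f M j (CellSearch.nearestDist X M ω i)) ∧
    MeasureTheory.condLExp (CellSearch.distSigma X M) μ (CellSearch.numCycles p X F M)
      =ᵐ[μ] fun ω =>
        ∑' j : ℕ, ∏ i : Fin M, ENNReal.ofReal (p.f M j (CellSearch.nearestDist X M ω i)) :=
  ⟨CellSearch.condExp_undetected hp hnet, CellSearch.condLExp_numCycles hp hnet⟩
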